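/- **Theorem 3.8.** Let $n\ge 2$, let $\mathbb P^n=\{z\in\mathbb C^n: |z_i|<1,\ i=1,\dots,n\}$ be the unit polydisk, and put $|z|_\infty=\max_i|z_i|$. Let $P^k_{ij}$ and $P^0_{ij}$ $(i,j,k=1,\dots,n)$ be holomorphic functions on $\mathbb P^n$, and consider the system $$\frac{\partial^2u}{\partial z_i\partial z_j}=\sum_{k=1}^nP^k_{ij}(z)\frac{\partial u}{\partial z_k}+P^0_{ij}(z)\,u,\qquad i,j=1,\dots,n, \tag{1}$$ for holomorphic functions $u$ on $\mathbb P^n$. Suppose that (1) is completely integrable (it has $n+1$ linearly independent solutions on $\mathbb P^n$) and in canonical form ($\sum_{j=1}^nP^j_{ij}=0$ on $\mathbb P^n$ for every $i$). For $z\in\mathbb P^n$ and $v\in\mathbb C^n$ let $$\|v\|_z=\Big[2\sum_{i=1}^n\frac{|v_i|^2}{(1-|z_i|^2)^2}\Big]^{1/2},\qquad S(z)(v)=\Big(\sum_{i,j=1}^nP^k_{ij}(z)v_iv_j\Big)_{k=1}^n,\qquad \|P\|=\sup_{z\in\mathbb P^n}\ \sup_{\|v\|_z=1}\|S(z)(v)\|_z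 .$$ Let $\alpha\ge0$ satisfy $\|P\|\le\alpha$ and $$n\sqrt n\,\alpha\le\frac1{6.1}.$$ Let $u$ be the solution of (1) with $u(0)=1$ and $\nabla u(0)=0$, where $\nabla u=(\partial u/\partial z_1,\dots,\partial u/\partial z_n)$. Then $u$ has no zeros in $\mathbb P^n$, and $$\left|\frac{\nabla u}{u}(z)\right|\le\frac{|z|_\infty}{1-|z|_\infty^2}\qquad\text{for all } z\in\mathbb P^n,$$ where $|\cdot|$ on the left is the Euclidean norm on $\mathbb C^n$. -/

import Mathlib

open scoped NNReal ENNReal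

namespace PolydiskSchwarzian

noncomputable section

/-- The open unit polydisk in `ℂⁿ`. On `Fin n → ℂ` Mathlib's norm is the maximum norm
`|z|_∞ = max_i |z_i|`. -/
def polydisk (n : ℕ) : Set (Fin n → ℂ) := {z | ∀ i, ‖z i‖ < 1}

/-- The complex partial derivative `∂u/∂z_i`. -/
def pd {n : ℕ} (i : Fin n) (u : (Fin n → ℂ) → ℂ) (z : Fin n → ℂ) : ℂ :=
  fderiv ℂ u z (Pi.single i 1)

/-- The complex gradient `∇u = (∂u/∂z_1, …, ∂u/∂z_n)`, as a vector with the Euclidean norm. -/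
def grad {n : ℕ} (u : (Fin n → ℂ) → ℂ) (z : Fin n → ℂ) : EuclideanSpace ℂ (Fin n) :=
  WithLp.toLp 2 fun i => pd i u z

/-- `u` is a holomorphic solution on the polydisk of the over-determined linear system
`∂²u/∂z_i∂z_j = ∑_k P^k_ij ∂u/∂z_k + P⁰_ij u`, for all `i, j`.
Here `P k i j` stands for `P^k_ij` and `P₀ i j` for `P⁰_ij`. -/
def IsSolution {n : ℕ} (P : Fin n → Fin n → Fin n → (Fin n → ℂ) → ℂ)
    (P₀ : Fin n → Fin n → (Fin n → ℂ) → ℂ) (u : (Fin n → ℂ) → ℂ) : Prop :=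
  AnalyticOnNhd ℂ u (polydisk n) ∧
    ∀ z ∈ polydisk n, ∀ i j : Fin n,
      pd i (pd j u) z = ∑ k, P k i j z * pd k u z + P₀ i j z * u z

/-- All the coefficients of the system are holomorphic in the polydisk. -/
def HolomorphicCoeffs {n : ℕ} (P : Fin n → Fin n → Fin n → (Fin n → ℂ) → ℂ)
    (P₀ : Fin n → Fin n → (Fin n → ℂ) → ℂ) : Prop :=
  (∀ k i j, AnalyticOnNhd ℂ (P k i j) (polydisk n)) ∧
    ∀ i j, AnalyticOnNhd ℂ (P₀ i j) (polydisk n)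

/-- The system is completely integrable: it has `n + 1` solutions that are linearly independent
as functions on the polydisk. -/
def CompletelyIntegrable {n : ℕ} (P : Fin n → Fin n → Fin n → (Fin n → ℂ) → ℂ)
    (P₀ : Fin n → Fin n → (Fin n → ℂ) → ℂ) : Prop :=
  ∃ U : Fin (n + 1) → (Fin n → ℂ) → ℂ,
    (∀ a, IsSolution P P₀ (U a)) ∧
      LinearIndependent ℂ fun (a : Fin (n + 1)) (z : polydisk n) => U a z

/-- The system is in canonical form: `∑_j P^j_ij = 0` in the polydisk, for every `i`. -/
def CanonicalForm {n : ℕ} (P : Fin n → Fin n → Fin n → (Fin n → ℂ) → ℂ) : Prop :=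
  ∀ z ∈ polydisk n, ∀ i, ∑ j, P j i j z = 0

/-- The Bergman norm `[2 ∑_i |v_i|² / (1 - |z_i|²)²]^{1/2}` of the tangent vector `v` at the
point `z` of the polydisk. -/
def bergmanNorm {n : ℕ} (z v : Fin n → ℂ) : ℝ :=
  √(2 * ∑ i, ‖v i‖ ^ 2 / (1 - ‖z i‖ ^ 2) ^ 2)

/-- The Schwarzian operator at `z`, `v ↦ (vᵗ P¹(z) v, …, vᵗ Pⁿ(z) v)`, where `P^k` is the
matrix `(P^k_ij)_{i,j}`; it is the Schwarzian derivative operator `S_f(z)` of every mapping `f`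
whose Schwarzian derivatives `S^k_ij f` are the `P^k_ij`. -/
def schwarzianOp {n : ℕ} (P : Fin n → Fin n → Fin n → (Fin n → ℂ) → ℂ)
    (z v : Fin n → ℂ) : Fin n → ℂ :=
  fun k => ∑ i, ∑ j, v i * P k i j z * v j

/-- The norm `‖P‖ = sup_z sup_{‖v‖ = 1} ‖S(z)(v)‖`, with the Bergman norms at `z` in the source
and in the target; it is `∞` when the supremum is not finite. -/
def schwarzianNorm {n : ℕ} (P : Fin n → Fin n → Fin n → (Fin n → ℂ) → ℂ) : ℝ≥0∞ :=
  ⨆ z ∈ polydisk n, ⨆ v : Fin n → ℂ, ⨆ _ : bergmanNorm z v = 1,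
    ENNReal.ofReal (bergmanNorm z (schwarzianOp P z v))

end

end PolydiskSchwarzian

namespace PolydiskSchwarzian

/-! The logarithmic gradient $Y=\nabla u/u$ is estimated along rays $t\zeta$ with $|\zeta_i|=1$ for
all $i$. Such rays meet only tori $|z_i|=t$, where the Bergman norm is a multiple of the Euclidean
norm. There the system becomes the Riccati equation
$Y'=B(\zeta,\cdot)^{T}Y+P^0(\zeta,\cdot)-(\zeta\cdot Y)Y$, where $B$ is the bilinear form of $S$.
With $\beta=\sqrt2\,\alpha$, $\|B(\zeta,\cdot)\|\le\beta\sqrt n/(1-t^2)$ and each entry of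
$P^0(\zeta,\cdot)$ is at most $D/(1-t^2)^2$. The barrier $n^{-1/2}t/(1-t^2)$ then cannot be crossed
as long as $\beta\sqrt n+nD<1$ (`norm_logGrad_le_on_ray`).

The bound for $P^0$ comes from complete integrability. Every 1-jet at a point is realised by a
solution, so commuting third derivatives give identities between coefficients; their trace, in
canonical form, expresses $(n-1)P^0_{ij}$ through products of the $P^k_{ij}$ and a divergence
(`CompletelyIntegrable.coeff_zero_eq`). The divergence is small because $P^k_{ij}$ with
$k\notin\{i,j\}$ decays as $|z_k|\to1$ and so vanishes (`coeff_eq_zero`); Cauchy estimates handle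
the rest (`norm_coeff_zero_le_of_torus`).

The bound for $Y$ makes $|u|^2/(1-t^2)$ nondecreasing, so $u$ has no zero on these rays. The maximum
principle from the distinguished boundary carries this to the whole polydisk, applied to $1/u$ for
the zeros (`ne_zero_of_torus`) and to $\nabla u/u$ for the final estimate. -/

theorem polydisk_eq_ball (n : ℕ) : polydisk n = Metric.ball 0 1 := by
  ext z
  simp [polydisk, pi_norm_lt_iff one_pos]

theorem isOpen_polydisk (n : ℕ) : IsOpen (polydisk n) := by
  rw [polydisk_eq_ball]; exact Metric.isOpen_ball

theorem convex_polydisk (n : ℕ) : Convex ℝ (polydisk n) := by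
  rw [polydisk_eq_ball]; exact convex_ball 0 1

/-! ### Calculus of complex partial derivatives -/

theorem fderiv_apply_eq_sum_pd {n : ℕ} (f : (Fin n → ℂ) → ℂ) (z v : Fin n → ℂ) :
    fderiv ℂ f z v = ∑ i, v i * pd i f z := by
  conv_lhs => rw [← Finset.univ_sum_single v, map_sum]
  refine Finset.sum_congr rfl fun i _ => ?_
  have : (Pi.single i (v i) : Fin n → ℂ) = v i • Pi.single i (1 : ℂ) := by
    rw [← Pi.single_smul]; simp
  rw [this, map_smul, smul_eq_mul, pd]

theorem analyticOnNhd_pd {n : ℕ} {f : (Fin n → ℂ) → ℂ} {s : Set (Fin n → ℂ)}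
    (hf : AnalyticOnNhd ℂ f s) (i : Fin n) : AnalyticOnNhd ℂ (pd i f) s :=
  (ContinuousLinearMap.apply ℂ ℂ (Pi.single i (1 : ℂ) : Fin n → ℂ)).comp_analyticOnNhd hf.fderiv

theorem pd_congr {n : ℕ} {f g : (Fin n → ℂ) → ℂ} {s : Set (Fin n → ℂ)} (hs : IsOpen s)
    (h : ∀ z ∈ s, f z = g z) {z : Fin n → ℂ} (hz : z ∈ s) (i : Fin n) : pd i f z = pd i g z := by
  have : f =ᶠ[nhds z] g := Filter.eventually_of_mem (hs.mem_nhds hz) h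
  rw [pd, this.fderiv_eq, pd]

theorem pd_comm {n : ℕ} {f : (Fin n → ℂ) → ℂ} {z : Fin n → ℂ} (hf : AnalyticAt ℂ f z)
    (i j : Fin n) : pd i (pd j f) z = pd j (pd i f) z := by
  have key : ∀ a b : Fin n, pd a (pd b f) z =
      fderiv ℂ (fderiv ℂ f) z (Pi.single a 1) (Pi.single b 1) := by
    intro a b
    have h1 : HasFDerivAt (fderiv ℂ f) (fderiv ℂ (fderiv ℂ f) z) z :=
      hf.fderiv.differentiableAt.hasFDerivAt
    have h2 := (ContinuousLinearMap.apply ℂ ℂ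
      (Pi.single b (1 : ℂ) : Fin n → ℂ)).hasFDerivAt.comp z h1
    have h3 : fderiv ℂ (pd b f) z = _ := h2.fderiv
    rw [pd, h3]
    rfl
  rw [key, key]
  exact (hf.contDiffAt (n := 2)).isSymmSndFDerivAt (by simp) _ _

theorem pd_add {n : ℕ} {f g : (Fin n → ℂ) → ℂ} {z : Fin n → ℂ} (hf : AnalyticAt ℂ f z)
    (hg : AnalyticAt ℂ g z) (i : Fin n) : pd i (fun x => f x + g x) z = pd i f z + pd i g z := by
  simp only [pd]
  rw [fderiv_fun_add hf.differentiableAt hg.differentiableAt]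
  rfl

theorem pd_mul {n : ℕ} {f g : (Fin n → ℂ) → ℂ} {z : Fin n → ℂ} (hf : AnalyticAt ℂ f z)
    (hg : AnalyticAt ℂ g z) (i : Fin n) :
    pd i (fun x => f x * g x) z = pd i f z * g z + f z * pd i g z := by
  simp only [pd]
  rw [fderiv_fun_mul hf.differentiableAt hg.differentiableAt]
  simp
  ring

theorem pd_sum {n : ℕ} {ι : Type*} (s : Finset ι) {f : ι → (Fin n → ℂ) → ℂ} {z : Fin n → ℂ}
    (hf : ∀ a ∈ s, AnalyticAt ℂ (f a) z) (i : Fin n) :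
    pd i (fun x => ∑ a ∈ s, f a x) z = ∑ a ∈ s, pd i (f a) z := by
  simp only [pd]
  rw [fderiv_fun_sum fun a ha => (hf a ha).differentiableAt]
  simp

theorem pd_const {n : ℕ} (c : ℂ) (i : Fin n) (z : Fin n → ℂ) : pd i (fun _ => c) z = 0 := by
  simp [pd]

/-- The partial derivative `∂f/∂z_i` is the derivative of the restriction to a coordinate line. -/
theorem hasDerivAt_comp_update {n : ℕ} {f : (Fin n → ℂ) → ℂ} {z : Fin n → ℂ} (i : Fin n) {t : ℂ}
    (hf : AnalyticAt ℂ f (Function.update z i t)) :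
    HasDerivAt (fun τ => f (Function.update z i τ)) (pd i f (Function.update z i t)) t := by
  have h1 : HasDerivAt (Function.update z i) (Pi.single i (1 : ℂ)) t := hasDerivAt_update z i t
  exact hf.differentiableAt.hasFDerivAt.comp_hasDerivAt t h1

/-- The derivative along a real line. -/
theorem hasDerivAt_line {n : ℕ} {f : (Fin n → ℂ) → ℂ} (z v : Fin n → ℂ) {t : ℝ}
    (hf : AnalyticAt ℂ f (z + (t : ℂ) • v)) :
    HasDerivAt (fun s : ℝ => f (z + (s : ℂ) • v)) (∑ i, v i * pd i f (z + (t : ℂ) • v)) t := by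
  have h1 : HasDerivAt (fun s : ℝ => z + (s : ℂ) • v) v t := by
    have := ((Complex.ofRealCLM.hasDerivAt (x := t)).smul_const v).const_add z
    simpa using this
  rw [← fderiv_apply_eq_sum_pd]
  exact (hf.differentiableAt.hasFDerivAt.restrictScalars ℝ).comp_hasDerivAt t h1

/-! ### Maximum principle on the polydisk -/

/-- The maximum principle on a closed polydisk, from its distinguished boundary. -/
theorem norm_le_of_forall_torus_norm_le {n : ℕ} {E : Type*} [NormedAddCommGroup E]
    [NormedSpace ℂ E] {f : (Fin n → ℂ) → E} {r C : ℝ} (hr : 0 < r)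
    (hf : ∀ z ∈ Metric.closedBall (0 : Fin n → ℂ) r, DifferentiableAt ℂ f z)
    (hC : ∀ z : Fin n → ℂ, (∀ i, ‖z i‖ = r) → ‖f z‖ ≤ C) :
    ∀ z ∈ Metric.closedBall (0 : Fin n → ℂ) r, ‖f z‖ ≤ C := by
  -- Induction on the set of coordinates still allowed inside the disk; each step pushes one
  -- coordinate to its circle by the one-variable principle.
  have main : ∀ s : Finset (Fin n), ∀ z ∈ Metric.closedBall (0 : Fin n → ℂ) r,
      (∀ i, i ∉ s → ‖z i‖ = r) → ‖f z‖ ≤ C := by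
    intro s
    induction s using Finset.induction_on with
    | empty => intro z _ h; exact hC z fun i => h i (by simp)
    | insert a s ha ih =>
      intro z hz h
      have hzi : ∀ i, ‖z i‖ ≤ r := by
        rw [mem_closedBall_zero_iff, pi_norm_le_iff_of_nonneg hr.le] at hz; exact hz
      have hmem : ∀ τ : ℂ, ‖τ‖ ≤ r → Function.update z a τ ∈
          Metric.closedBall (0 : Fin n → ℂ) r := by
        intro τ hτ
        rw [mem_closedBall_zero_iff, pi_norm_le_iff_of_nonneg hr.le]
        intro i
        by_cases hi : i = a
        · subst hi; simpa using hτ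
        · simpa [Function.update_of_ne hi] using hzi i
      have hd : DifferentiableOn ℂ (fun τ => f (Function.update z a τ))
          (Metric.closedBall (0 : ℂ) r) := by
        intro τ hτ
        have h1 : DifferentiableAt ℂ (Function.update z a) τ :=
          (hasDerivAt_update z a τ).differentiableAt
        exact ((hf _ (hmem τ (by simpa using hτ))).comp τ h1).differentiableWithinAt
      have := Complex.norm_le_of_forall_mem_frontier_norm_le (Metric.isBounded_ball (x := (0 : ℂ))
        (r := r)) (f := fun τ => f (Function.update z a τ)) (C := C)
        (hd.diffContOnCl_ball subset_rfl) ?_ (z := z a) ?_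
      · simpa using this
      · intro τ hτ
        rw [frontier_ball _ hr.ne', mem_sphere_zero_iff_norm] at hτ
        refine ih _ (hmem τ hτ.le) fun i hi => ?_
        by_cases hia : i = a
        · subst hia; simpa using hτ
        · rw [Function.update_of_ne hia]; exact h i (by simp [hia, hi])
      · rw [closure_ball _ hr.ne']; simpa using hzi a
  intro z hz
  exact main Finset.univ z hz fun i hi => absurd (Finset.mem_univ i) hi

/-! ### Derivative estimates in the disk through Möbius maps -/

theorem one_sub_normSq_moebius {a t : ℂ} (h : 1 + (starRingEnd ℂ) a * t ≠ 0) :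
    1 - ‖(t + a) / (1 + (starRingEnd ℂ) a * t)‖ ^ 2 =
      (1 - ‖a‖ ^ 2) * (1 - ‖t‖ ^ 2) / ‖1 + (starRingEnd ℂ) a * t‖ ^ 2 := by
  have h' : ‖1 + (starRingEnd ℂ) a * t‖ ^ 2 ≠ 0 := by positivity
  rw [norm_div, div_pow, eq_div_iff h', sub_mul, div_mul_cancel₀ _ h']
  simp only [← Complex.normSq_eq_norm_sq, Complex.normSq_apply]
  simp
  ring

theorem one_add_conj_mul_ne_zero {a t : ℂ} (ha : ‖a‖ < 1) (ht : ‖t‖ < 1) :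
    1 + (starRingEnd ℂ) a * t ≠ 0 := by
  intro h
  have h1 : ‖(starRingEnd ℂ) a * t‖ < 1 := by
    rw [norm_mul, RCLike.norm_conj]
    nlinarith [norm_nonneg a, norm_nonneg t]
  have h2 : (starRingEnd ℂ) a * t = -1 := by linear_combination h
  rw [h2] at h1
  simp at h1

theorem norm_moebius_lt_one {a t : ℂ} (ha : ‖a‖ < 1) (ht : ‖t‖ < 1) :
    ‖(t + a) / (1 + (starRingEnd ℂ) a * t)‖ < 1 := by
  have h := one_add_conj_mul_ne_zero ha ht
  have h1 := one_sub_normSq_moebius h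
  have h2 : 0 < (1 - ‖a‖ ^ 2) * (1 - ‖t‖ ^ 2) / ‖1 + (starRingEnd ℂ) a * t‖ ^ 2 := by
    have := norm_pos_iff.2 h
    have : 0 < 1 - ‖a‖ ^ 2 := by nlinarith [norm_nonneg a]
    have : 0 < 1 - ‖t‖ ^ 2 := by nlinarith [norm_nonneg t]
    positivity
  nlinarith [norm_nonneg ((t + a) / (1 + (starRingEnd ℂ) a * t))]

/-- A Cauchy estimate on a pseudo-hyperbolic circle, for the odd part of `f` in the coordinate
centred at `a`. -/
theorem norm_deriv_le_of_moebius_odd {f : ℂ → ℂ} (hf : ∀ t : ℂ, ‖t‖ < 1 → DifferentiableAt ℂ f t)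
    {a : ℂ} (ha : ‖a‖ < 1) {s M : ℝ} (hs : 0 < s) (hs1 : s < 1)
    (hM : ∀ t : ℂ, ‖t‖ = s → ‖f ((t + a) / (1 + (starRingEnd ℂ) a * t))‖ +
      ‖f ((-t + a) / (1 + (starRingEnd ℂ) a * (-t)))‖ ≤ 2 * M) :
    ‖deriv f a‖ * (1 - ‖a‖ ^ 2) ≤ M / s := by
  set φ : ℂ → ℂ := fun t => (t + a) / (1 + (starRingEnd ℂ) a * t) with hφ
  have hφ' : ∀ t : ℂ, ‖t‖ < 1 → HasDerivAt φ
      ((1 * (1 + (starRingEnd ℂ) a * t) - (t + a) * ((starRingEnd ℂ) a * 1)) /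
        (1 + (starRingEnd ℂ) a * t) ^ 2) t := by
    intro t ht
    exact ((hasDerivAt_id t).add_const a).div (((hasDerivAt_id t).const_mul _).const_add 1)
      (one_add_conj_mul_ne_zero ha ht)
  have hg : ∀ t : ℂ, ‖t‖ < 1 → DifferentiableAt ℂ (fun t => f (φ t)) t := fun t ht =>
    (hf _ (norm_moebius_lt_one ha ht)).comp t (hφ' t ht).differentiableAt
  have hgn : ∀ t : ℂ, ‖t‖ < 1 → DifferentiableAt ℂ (fun t => f (φ (-t))) t := fun t ht =>
    (hg (-t) (by simpa using ht)).comp t differentiableAt_id.neg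
  have hφ0 : φ 0 = a := by simp [hφ]
  have hsub : ∀ t ∈ Metric.closedBall (0 : ℂ) s, ‖t‖ < 1 := fun t ht =>
    (mem_closedBall_zero_iff.1 ht).trans_lt hs1
  -- The odd part of $f\circ\varphi$ has the same derivative at $0$ as $f\circ\varphi$, namely
  -- $f'(a)(1-|a|^2)$.
  have hd : DifferentiableOn ℂ (fun t => (f (φ t) - f (φ (-t))) / 2) (Metric.closedBall 0 s) :=
    fun t ht => (((hg t (hsub t ht)).sub (hgn t (hsub t ht))).div_const 2).differentiableWithinAt
  have hC := Complex.norm_deriv_le_of_forall_mem_sphere_norm_le hs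
    (hd.diffContOnCl_ball subset_rfl) (C := M) ?_
  · have h0 : HasDerivAt φ ((1 - ‖a‖ ^ 2 : ℝ) : ℂ) 0 := by
      convert hφ' 0 (by simp) using 1
      have : a * (starRingEnd ℂ) a = ((‖a‖ ^ 2 : ℝ) : ℂ) := by
        rw [Complex.mul_conj, Complex.normSq_eq_norm_sq]
      push_cast at this ⊢
      simp [this]
    have hfa : HasDerivAt f (deriv f a) (φ 0) := by
      rw [hφ0]; exact (hf a ha).hasDerivAt
    have h1 : HasDerivAt (fun t => f (φ t)) (deriv f a * ((1 - ‖a‖ ^ 2 : ℝ) : ℂ)) 0 :=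
      hfa.comp 0 h0
    have h1' : HasDerivAt (fun t => f (φ t)) (deriv f a * ((1 - ‖a‖ ^ 2 : ℝ) : ℂ)) (-0) := by
      rwa [neg_zero]
    have h2 : HasDerivAt (fun t => f (φ (-t))) (deriv f a * ((1 - ‖a‖ ^ 2 : ℝ) : ℂ) * (-1)) 0 :=
      h1'.comp 0 (hasDerivAt_neg 0)
    have h3 := ((h1.sub h2).div_const 2).deriv
    have h4 : deriv (fun t => (f (φ t) - f (φ (-t))) / 2) 0 =
        deriv f a * ((1 - ‖a‖ ^ 2 : ℝ) : ℂ) := by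
      rw [show (fun t => (f (φ t) - f (φ (-t))) / 2) =
        fun x => ((fun t => f (φ t)) - fun t => f (φ (-t))) x / 2 from rfl, h3]
      ring
    rw [h4, norm_mul, Complex.norm_real, Real.norm_of_nonneg] at hC
    · exact hC
    · nlinarith [norm_nonneg a]
  · intro t ht
    have h1 := hM t (mem_sphere_zero_iff_norm.1 ht)
    rw [norm_div, Complex.norm_ofNat, div_le_iff₀ two_pos]
    have h2 := norm_sub_le (f (φ t)) (f (φ (-t)))
    simp only [hφ] at h2 ⊢
    linarith

/-- The Schwarz–Pick derivative bound for functions bounded by `K`. -/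
theorem norm_deriv_le_of_norm_le {f : ℂ → ℂ} (hf : ∀ t : ℂ, ‖t‖ < 1 → DifferentiableAt ℂ f t)
    {K : ℝ} (hK : ∀ t : ℂ, ‖t‖ < 1 → ‖f t‖ ≤ K) {a : ℂ} (ha : ‖a‖ < 1) :
    ‖deriv f a‖ ≤ K / (1 - ‖a‖ ^ 2) := by
  have hK0 : 0 ≤ K := (norm_nonneg _).trans (hK a ha)
  have ha2 : 0 < 1 - ‖a‖ ^ 2 := by nlinarith [norm_nonneg a]
  rw [le_div_iff₀ ha2]
  have h : ∀ s ∈ Set.Ioo (0 : ℝ) 1, ‖deriv f a‖ * (1 - ‖a‖ ^ 2) * s ≤ K := by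
    intro s hs
    rw [← le_div_iff₀ hs.1]
    refine norm_deriv_le_of_moebius_odd hf ha hs.1 hs.2 fun t ht => ?_
    have h1 := hK _ (norm_moebius_lt_one ha (t := t) (by rw [ht]; exact hs.2))
    have h2 := hK _ (norm_moebius_lt_one ha (t := -t) (by rw [norm_neg, ht]; exact hs.2))
    linarith
  have hlim : Filter.Tendsto (fun s : ℝ => ‖deriv f a‖ * (1 - ‖a‖ ^ 2) * s)
      (nhdsWithin 1 (Set.Iio 1)) (nhds (‖deriv f a‖ * (1 - ‖a‖ ^ 2) * 1)) :=
    ((continuous_const.mul continuous_id).tendsto 1).mono_left nhdsWithin_le_nhds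
  rw [mul_one] at hlim
  refine le_of_tendsto hlim ?_
  filter_upwards [Ioo_mem_nhdsLT (zero_lt_one' ℝ)] with s hs using h s hs

/-- A derivative bound for functions bounded by `K / (1 - |t|²)`. -/
theorem norm_deriv_le_of_norm_le_div {f : ℂ → ℂ}
    (hf : ∀ t : ℂ, ‖t‖ < 1 → DifferentiableAt ℂ f t) {K : ℝ}
    (hK : ∀ t : ℂ, ‖t‖ < 1 → ‖f t‖ ≤ K / (1 - ‖t‖ ^ 2)) {a : ℂ} (ha : ‖a‖ < 1) :
    ‖deriv f a‖ ≤ 10 / 3 * K / (1 - ‖a‖ ^ 2) ^ 2 := by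
  have hK0 : 0 ≤ K := by simpa using (norm_nonneg _).trans (hK 0 (by simp))
  have ha2 : 0 < 1 - ‖a‖ ^ 2 := by nlinarith [norm_nonneg a]
  have hb : ∀ t : ℂ, ‖t‖ = 1 / 2 → ‖f ((t + a) / (1 + (starRingEnd ℂ) a * t))‖ ≤
      4 / 3 * K * ‖1 + (starRingEnd ℂ) a * t‖ ^ 2 / (1 - ‖a‖ ^ 2) := by
    intro t ht
    have ht1 : ‖t‖ < 1 := by rw [ht]; norm_num
    have h := one_add_conj_mul_ne_zero ha ht1
    have h1 := hK _ (norm_moebius_lt_one ha ht1)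
    rw [one_sub_normSq_moebius h, ht] at h1
    refine h1.trans_eq ?_
    field_simp
    norm_num
    ring
  -- On $|t|=1/2$ the weight gives $\tfrac43$, and averaging over $\pm t$ removes the cross term of
  -- $|1+\bar a t|^2$, leaving $1+|a|^2/4\le\tfrac54$. Hence $\tfrac53$, and $\tfrac{10}3$ after
  -- dividing by the radius; without the averaging the constant would be $6$.
  have h := norm_deriv_le_of_moebius_odd hf ha (s := 1 / 2) (M := 5 / 3 * K / (1 - ‖a‖ ^ 2))
    (by norm_num) (by norm_num) ?_
  · rw [le_div_iff₀ (by positivity)]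
    have h2 : 5 / 3 * K / (1 - ‖a‖ ^ 2) / (1 / 2) * (1 - ‖a‖ ^ 2) = 10 / 3 * K := by
      field_simp
      ring
    nlinarith
  · intro t ht
    have h1 := hb t ht
    have h2 := hb (-t) (by rw [norm_neg, ht])
    have h3 := parallelogram_law_with_norm ℝ (1 : ℂ) ((starRingEnd ℂ) a * t)
    rw [norm_mul, RCLike.norm_conj, ht, norm_one] at h3
    rw [mul_neg, ← sub_eq_add_neg] at h2
    rw [mul_neg, ← sub_eq_add_neg]
    have h4 : 4 / 3 * K * ‖1 + (starRingEnd ℂ) a * t‖ ^ 2 / (1 - ‖a‖ ^ 2) +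
        4 / 3 * K * ‖1 - (starRingEnd ℂ) a * t‖ ^ 2 / (1 - ‖a‖ ^ 2) =
        4 / 3 * K * (2 * (1 + ‖a‖ ^ 2 / 4)) / (1 - ‖a‖ ^ 2) := by
      rw [← add_div]; congr 1; linear_combination (4 / 3 * K) * h3
    refine (add_le_add h1 h2).trans (h4.trans_le ?_)
    rw [← mul_div_assoc]
    refine div_le_div_of_nonneg_right ?_ ha2.le
    nlinarith [mul_nonneg hK0 ha2.le]

/-! ### Solution space, compatibility conditions and the formula for P⁰ -/

variable {n : ℕ} {P : Fin n → Fin n → Fin n → (Fin n → ℂ) → ℂ}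
  {P₀ : Fin n → Fin n → (Fin n → ℂ) → ℂ}

theorem pd_linearCombination {ι : Type*} [Fintype ι] {U : ι → (Fin n → ℂ) → ℂ}
    {z : Fin n → ℂ} (hU : ∀ a, AnalyticAt ℂ (U a) z) (c : ι → ℂ) (i : Fin n) :
    pd i (fun x => ∑ a, c a * U a x) z = ∑ a, c a * pd i (U a) z := by
  rw [pd_sum _ (f := fun a x => c a * U a x) fun a _ => analyticAt_const.mul (hU a)]
  refine Finset.sum_congr rfl fun a _ => ?_
  rw [pd_mul analyticAt_const (hU a), pd_const, zero_mul, zero_add]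

theorem IsSolution.linearCombination {ι : Type*} [Fintype ι] {U : ι → (Fin n → ℂ) → ℂ}
    (hU : ∀ a, IsSolution P P₀ (U a)) (c : ι → ℂ) :
    IsSolution P P₀ fun x => ∑ a, c a * U a x := by
  refine ⟨fun z hz => Finset.analyticAt_fun_sum _ fun a _ =>
    analyticAt_const.mul ((hU a).1 z hz), fun z hz i j => ?_⟩
  rw [pd_congr (isOpen_polydisk n) (fun x hx => pd_linearCombination (fun a => (hU a).1 x hx) c j)
    hz i, pd_linearCombination (fun a => analyticOnNhd_pd (hU a).1 j z hz)]
  simp only [pd_linearCombination (fun a => (hU a).1 z hz), (hU _).2 z hz, mul_add,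
    Finset.sum_add_distrib, Finset.mul_sum]
  congr 1
  · rw [Finset.sum_comm]
    exact Finset.sum_congr rfl fun _ _ => Finset.sum_congr rfl fun _ _ => by ring
  · exact Finset.sum_congr rfl fun _ _ => by ring

/-- A solution is determined by its value and its gradient at one point. -/
theorem IsSolution.eq_zero (hP : HolomorphicCoeffs P P₀) {w : (Fin n → ℂ) → ℂ}
    (hw : IsSolution P P₀ w) {z : Fin n → ℂ} (hz : z ∈ polydisk n) (h0 : w z = 0)
    (h1 : ∀ k, pd k w z = 0) {x : Fin n → ℂ} (hx : x ∈ polydisk n) : w x = 0 := by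
  set v : Fin n → ℂ := x - z with hv
  set γ : ℝ → (Fin n → ℂ) := fun t => z + (t : ℂ) • v with hγ
  have hγmem : ∀ t ∈ Set.Icc (0 : ℝ) 1, γ t ∈ polydisk n := by
    intro t ht
    have := (convex_polydisk n).add_smul_sub_mem hz hx ht
    rw [← hv, ← Complex.coe_smul] at this
    exact this
  have hγc : Continuous γ := by fun_prop
  have hcont : ∀ f : (Fin n → ℂ) → ℂ, AnalyticOnNhd ℂ f (polydisk n) →
      ContinuousOn (fun t => f (γ t)) (Set.Icc 0 1) := fun f hf =>
    hf.continuousOn.comp hγc.continuousOn hγmem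
  set F : ℝ → (Fin n → ℂ) × ℂ := fun t => (fun k => pd k w (γ t), w (γ t)) with hF
  set F' : ℝ → (Fin n → ℂ) × ℂ := fun t =>
    (fun k => ∑ i, v i * pd i (pd k w) (γ t), ∑ i, v i * pd i w (γ t)) with hF'
  have hderiv : ∀ t ∈ Set.Icc (0 : ℝ) 1, HasDerivAt F (F' t) t := fun t ht =>
    (hasDerivAt_pi.2 fun k =>
      hasDerivAt_line z v (analyticOnNhd_pd hw.1 k _ (hγmem t ht))).prodMk
      (hasDerivAt_line z v (hw.1 _ (hγmem t ht)))
  -- A crude bound for the matrix of the linear ODE satisfied by the 1-jet of $w$ along the segment;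
  -- continuity on a compact interval makes it a Grönwall constant.
  set κ : ℝ → ℝ := fun t => (∑ i, ‖v i‖) +
    ∑ j, ∑ i, ‖v i‖ * ((∑ k, ‖P k i j (γ t)‖) + ‖P₀ i j (γ t)‖) with hκ
  have hκc : ContinuousOn κ (Set.Icc 0 1) := by
    refine continuousOn_const.add (continuousOn_finsetSum _ fun j _ =>
      continuousOn_finsetSum _ fun i _ => continuousOn_const.mul ((continuousOn_finsetSum _
        fun k _ => ?_).add ?_))
    · exact (hcont _ (hP.1 k i j)).norm
    · exact (hcont _ (hP.2 i j)).norm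
  obtain ⟨K, hK⟩ := isCompact_Icc.exists_bound_of_continuousOn hκc
  have hbound : ∀ t ∈ Set.Ico (0 : ℝ) 1, ‖F' t‖ ≤ K * ‖F t‖ := by
    intro t ht
    have ht' : t ∈ Set.Icc (0 : ℝ) 1 := ⟨ht.1, ht.2.le⟩
    have hpd : ∀ k, ‖pd k w (γ t)‖ ≤ ‖F t‖ := fun k =>
      (norm_le_pi_norm (F t).1 k).trans (norm_fst_le (F t))
    have hwn : ‖w (γ t)‖ ≤ ‖F t‖ := norm_snd_le (F t)
    have hpos : ∀ j, 0 ≤ ∑ i, ‖v i‖ * ((∑ k, ‖P k i j (γ t)‖) + ‖P₀ i j (γ t)‖) := fun j => by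
      positivity
    have hle : ‖F' t‖ ≤ κ t * ‖F t‖ := by
      have hκ0 : 0 ≤ κ t := add_nonneg (by positivity) (Finset.sum_nonneg fun j _ => hpos j)
      rw [Prod.norm_def, max_le_iff, pi_norm_le_iff_of_nonneg (by positivity)]
      constructor
      · intro j
        calc ‖∑ i, v i * pd i (pd j w) (γ t)‖
            ≤ ∑ i, ‖v i‖ * ((∑ k, ‖P k i j (γ t)‖) + ‖P₀ i j (γ t)‖) * ‖F t‖ := by
              refine norm_sum_le_of_le _ fun i _ => ?_
              rw [norm_mul, mul_assoc, hw.2 _ (hγmem t ht')]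
              refine mul_le_mul_of_nonneg_left ?_ (norm_nonneg _)
              rw [add_mul, Finset.sum_mul]
              refine (norm_add_le _ _).trans (add_le_add (norm_sum_le_of_le _ fun k _ => ?_) ?_)
              · rw [norm_mul]; exact mul_le_mul_of_nonneg_left (hpd k) (norm_nonneg _)
              · rw [norm_mul]; exact mul_le_mul_of_nonneg_left hwn (norm_nonneg _)
          _ = (∑ i, ‖v i‖ * ((∑ k, ‖P k i j (γ t)‖) + ‖P₀ i j (γ t)‖)) * ‖F t‖ := by
              rw [Finset.sum_mul]
          _ ≤ κ t * ‖F t‖ := by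
              refine mul_le_mul_of_nonneg_right ?_ (norm_nonneg _)
              refine le_add_of_nonneg_of_le (by positivity) ?_
              exact Finset.single_le_sum (f := fun j =>
                ∑ i, ‖v i‖ * ((∑ k, ‖P k i j (γ t)‖) + ‖P₀ i j (γ t)‖)) (fun j _ => hpos j)
                (Finset.mem_univ j)
      · calc ‖∑ i, v i * pd i w (γ t)‖ ≤ ∑ i, ‖v i‖ * ‖F t‖ := by
              refine norm_sum_le_of_le _ fun i _ => ?_
              rw [norm_mul]; exact mul_le_mul_of_nonneg_left (hpd i) (norm_nonneg _)
          _ = (∑ i, ‖v i‖) * ‖F t‖ := by rw [Finset.sum_mul]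
          _ ≤ κ t * ‖F t‖ := by
              refine mul_le_mul_of_nonneg_right ?_ (norm_nonneg _)
              exact le_add_of_nonneg_right (Finset.sum_nonneg fun j _ => hpos j)
    refine hle.trans (mul_le_mul_of_nonneg_right ?_ (norm_nonneg _))
    exact (le_abs_self _).trans (hK t ht')
  have hγ0 : γ 0 = z := by simp [hγ]
  have hγ1 : γ 1 = x := by simp [hγ, hv]
  have hFa : F 0 = 0 := by
    simp only [hF, hγ0, h0, h1]
    rfl
  have := eq_zero_of_abs_deriv_le_mul_abs_self_of_eq_zero_right
    (fun t ht => (hderiv t ht).continuousAt.continuousWithinAt)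
    (fun t ht => (hderiv t ⟨ht.1, ht.2.le⟩).hasDerivWithinAt) hFa hbound 1 (by simp)
  have h2 : (F 1).2 = 0 := by rw [this]; rfl
  simpa [hF, hγ1] using h2

/-- In a completely integrable system, a linear relation between the value and the gradient at a
point that holds for all solutions is trivial. -/
theorem CompletelyIntegrable.eq_zero_of_relation (hP : HolomorphicCoeffs P P₀)
    (hint : CompletelyIntegrable P P₀) {z : Fin n → ℂ} (hz : z ∈ polydisk n) (c : Fin n → ℂ)
    (c₀ : ℂ) (h : ∀ w, IsSolution P P₀ w → ∑ k, c k * pd k w z + c₀ * w z = 0) (k : Fin n) :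
    c k = 0 := by
  obtain ⟨U, hU, hlin⟩ := hint
  rw [Fintype.linearIndependent_iff] at hlin
  let J : (Fin (n + 1) → ℂ) →ₗ[ℂ] (Fin n → ℂ) × ℂ :=
    Fintype.linearCombination ℂ fun a => (fun k => pd k (U a) z, U a z)
  have hJ : ∀ d, J d = (fun k => pd k (fun x => ∑ a, d a * U a x) z, ∑ a, d a * U a z) := by
    intro d
    rw [Fintype.linearCombination_apply]
    ext
    · simp [Prod.fst_sum, pd_linearCombination (fun a => (hU a).1 z hz)]
    · simp [Prod.snd_sum]
  -- Injectivity is uniqueness from the 1-jet; since both dimensions are $n+1$, every jet is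
  -- attained, and the jet $(e_k,0)$ isolates $c_k$.
  have hinj : Function.Injective J := by
    rw [← LinearMap.ker_eq_bot, LinearMap.ker_eq_bot']
    intro d hd
    rw [hJ, Prod.mk_eq_zero] at hd
    funext a
    refine hlin d ?_ a
    funext x
    have := (IsSolution.linearCombination hU d).eq_zero hP hz hd.2 (fun k => congrFun hd.1 k) x.2
    simpa using this
  have hsurj : Function.Surjective J :=
    (LinearMap.injective_iff_surjective_of_finrank_eq_finrank (by simp)).1 hinj
  obtain ⟨d, hd⟩ := hsurj (Pi.single k 1, 0)
  rw [hJ, Prod.mk.injEq] at hd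
  have h1 := h _ (IsSolution.linearCombination hU d)
  simp only [congrFun hd.1, hd.2] at h1
  simpa [Pi.single_apply] using h1

/-- Mixed second derivatives of every solution commute, which is a linear relation on its 1-jet. -/
theorem CompletelyIntegrable.coeff_symm (hP : HolomorphicCoeffs P P₀)
    (hint : CompletelyIntegrable P P₀) {z : Fin n → ℂ} (hz : z ∈ polydisk n) (k i j : Fin n) :
    P k i j z = P k j i z := by
  have := hint.eq_zero_of_relation hP hz (fun k => P k i j z - P k j i z)
    (P₀ i j z - P₀ j i z) (fun w hw => ?_) k
  · exact sub_eq_zero.1 this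
  · have h := pd_comm (hw.1 z hz) i j
    rw [hw.2 z hz, hw.2 z hz] at h
    simp only [sub_mul, Finset.sum_sub_distrib]
    linear_combination h

/-- Reducing third derivatives to the 1-jet turns their commutation into a linear relation on jets.
-/
theorem IsSolution.pd_pd_pd (hP : HolomorphicCoeffs P P₀) {w : (Fin n → ℂ) → ℂ}
    (hw : IsSolution P P₀ w) {z : Fin n → ℂ} (hz : z ∈ polydisk n) (l i j : Fin n) :
    pd l (pd i (pd j w)) z =
      ∑ m, (pd l (P m i j) z + ∑ k, P k i j z * P m l k z + if m = l then P₀ i j z else 0) *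
          pd m w z +
        (∑ k, P k i j z * P₀ l k z + pd l (P₀ i j) z) * w z := by
  have hPa := fun k => hP.1 k i j z hz
  have hwa := fun k => analyticOnNhd_pd hw.1 k z hz
  rw [pd_congr (isOpen_polydisk n) (fun x hx => hw.2 x hx i j) hz l,
    pd_add (f := fun x => ∑ k, P k i j x * pd k w x) (g := fun x => P₀ i j x * w x)
      (Finset.analyticAt_fun_sum _ fun k _ => (hPa k).mul (hwa k))
      ((hP.2 i j z hz).mul (hw.1 z hz)),
    pd_sum _ (f := fun k x => P k i j x * pd k w x) fun k _ => (hPa k).mul (hwa k), pd_mul (hP.2 i j z hz) (hw.1 z hz)]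
  simp only [pd_mul (hPa _) (hwa _), hw.2 z hz, add_mul, Finset.sum_add_distrib, mul_add,
    ite_mul, zero_mul, Finset.sum_ite_eq', Finset.mem_univ, if_true, Finset.mul_sum,
    Finset.sum_mul]
  have : ∑ k, ∑ m, P k i j z * (P m l k z * pd m w z) =
      ∑ m, ∑ k, P k i j z * P m l k z * pd m w z := by
    rw [Finset.sum_comm]
    exact Finset.sum_congr rfl fun _ _ => Finset.sum_congr rfl fun _ _ => by ring
  rw [this]
  have : ∑ k, P k i j z * (P₀ l k z * w z) = ∑ k, P k i j z * P₀ l k z * w z :=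
    Finset.sum_congr rfl fun _ _ => by ring
  rw [this]
  ring

/-- The compatibility conditions of a completely integrable system. -/
theorem CompletelyIntegrable.compatibility (hP : HolomorphicCoeffs P P₀)
    (hint : CompletelyIntegrable P P₀) {z : Fin n → ℂ} (hz : z ∈ polydisk n) (l i j m : Fin n) :
    (pd l (P m i j) z + ∑ k, P k i j z * P m l k z + if m = l then P₀ i j z else 0) =
      pd i (P m l j) z + ∑ k, P k l j z * P m i k z + if m = i then P₀ l j z else 0 := by
  have := hint.eq_zero_of_relation hP hz (fun m =>
    (pd l (P m i j) z + ∑ k, P k i j z * P m l k z + if m = l then P₀ i j z else 0) -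
      (pd i (P m l j) z + ∑ k, P k l j z * P m i k z + if m = i then P₀ l j z else 0))
    ((∑ k, P k i j z * P₀ l k z + pd l (P₀ i j) z) -
      (∑ k, P k l j z * P₀ i k z + pd i (P₀ l j) z)) (fun w hw => ?_) m
  · exact sub_eq_zero.1 this
  · have h := pd_comm (analyticOnNhd_pd hw.1 j z hz) l i
    rw [hw.pd_pd_pd hP hz, hw.pd_pd_pd hP hz] at h
    simp only [sub_mul, Finset.sum_sub_distrib]
    linear_combination h

/-- In canonical form the coefficients `P⁰_ij` are determined by the `P^k_ij`. -/
theorem CompletelyIntegrable.coeff_zero_eq (hP : HolomorphicCoeffs P P₀)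
    (hint : CompletelyIntegrable P P₀) (hcan : CanonicalForm P) {z : Fin n → ℂ}
    (hz : z ∈ polydisk n) (i j : Fin n) :
    ((n : ℂ) - 1) * P₀ i j z =
      ∑ k, ∑ l, P k l j z * P l i k z - ∑ l, pd l (P l i j) z := by
  -- Trace over $m=l$: the Kronecker terms leave $nP^0_{ij}-P^0_{ij}$, and canonical form with
  -- symmetry kills the terms containing $\sum_l P^l_{lk}$.
  have h := Finset.sum_congr rfl fun l (_ : l ∈ Finset.univ) =>
    hint.compatibility hP hz l i j l
  simp only [Finset.sum_add_distrib, if_true, Finset.sum_ite_eq', Finset.mem_univ,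
    Finset.sum_const, Finset.card_univ, Fintype.card_fin, nsmul_eq_mul] at h
  have h1 : ∑ l, ∑ k, P k i j z * P l l k z = 0 := by
    rw [Finset.sum_comm]
    refine Finset.sum_eq_zero fun k _ => ?_
    rw [← Finset.mul_sum, Finset.sum_congr rfl fun l _ => hint.coeff_symm hP hz l l k,
      hcan z hz k, mul_zero]
  have h2 : ∑ l, pd i (P l l j) z = 0 := by
    rw [← pd_sum _ fun l _ => hP.1 l l j z hz, pd_congr (isOpen_polydisk n) (g := fun _ => 0) _ hz,
      pd_const]
    intro x hx
    rw [← hcan x hx j]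
    exact Finset.sum_congr rfl fun l _ => hint.coeff_symm hP hx l l j
  rw [h1, h2] at h
  rw [Finset.sum_comm]
  linear_combination h

/-! ### Bergman norm and bounds for the coefficients -/

theorem one_sub_sq_pos {z : Fin n → ℂ} (hz : z ∈ polydisk n) (i : Fin n) : 0 < 1 - ‖z i‖ ^ 2 := by
  nlinarith [hz i, norm_nonneg (z i)]

/-- The tangent vector `v` at `z`, in coordinates in which the Bergman norm at `z` is `√2` times
the Euclidean norm. -/
noncomputable def weighted (z : Fin n → ℂ) : (Fin n → ℂ) →ₗ[ℂ] EuclideanSpace ℂ (Fin n) where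
  toFun v := WithLp.toLp 2 fun i => (((1 - ‖z i‖ ^ 2 : ℝ) : ℂ))⁻¹ * v i
  map_add' v w := by ext i; simp [mul_add]
  map_smul' c v := by ext i; simp; ring

theorem weighted_apply (z v : Fin n → ℂ) (i : Fin n) :
    weighted z v i = (((1 - ‖z i‖ ^ 2 : ℝ) : ℂ))⁻¹ * v i := rfl

theorem bergmanNorm_eq (z v : Fin n → ℂ) : bergmanNorm z v = √2 * ‖weighted z v‖ := by
  rw [EuclideanSpace.norm_eq, ← Real.sqrt_mul zero_le_two, bergmanNorm]
  congr 2
  refine Finset.sum_congr rfl fun i _ => ?_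
  rw [weighted_apply, norm_mul, norm_inv, Complex.norm_real, mul_pow, inv_pow, Real.norm_eq_abs,
    sq_abs, div_eq_inv_mul]

theorem weighted_eq_zero {z v : Fin n → ℂ} (hz : z ∈ polydisk n) (h : weighted z v = 0) :
    v = 0 := by
  funext i
  have h1 : weighted z v i = 0 := by rw [h]; rfl
  rw [weighted_apply] at h1
  have h2 : (((1 - ‖z i‖ ^ 2 : ℝ) : ℂ))⁻¹ ≠ 0 :=
    inv_ne_zero (Complex.ofReal_ne_zero.2 (one_sub_sq_pos hz i).ne')
  exact (mul_eq_zero.1 h1).resolve_left h2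

/-- The bilinear operator whose diagonal is the Schwarzian operator. -/
noncomputable def bilinOp (P : Fin n → Fin n → Fin n → (Fin n → ℂ) → ℂ) (z v w : Fin n → ℂ) :
    Fin n → ℂ :=
  fun k => ∑ i, ∑ j, v i * P k i j z * w j

theorem schwarzianOp_smul (z v : Fin n → ℂ) (c : ℂ) :
    schwarzianOp P z (c • v) = c ^ 2 • schwarzianOp P z v := by
  funext k
  simp only [schwarzianOp, Pi.smul_apply, smul_eq_mul, Finset.mul_sum]
  exact Finset.sum_congr rfl fun _ _ => Finset.sum_congr rfl fun _ _ => by ring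

theorem bilinOp_smul_smul (z v w : Fin n → ℂ) (c d : ℂ) :
    bilinOp P z (c • v) (d • w) = (c * d) • bilinOp P z v w := by
  funext k
  simp only [bilinOp, Pi.smul_apply, smul_eq_mul, Finset.mul_sum]
  exact Finset.sum_congr rfl fun _ _ => Finset.sum_congr rfl fun _ _ => by ring

/-- The operator is quadratic while the Bergman norm is $\sqrt2$ times the weighted one, so one
factor $\sqrt2$ survives. -/
theorem norm_weighted_schwarzianOp_le {α : ℝ≥0} (hnorm : schwarzianNorm P ≤ (α : ℝ≥0∞))
    {z : Fin n → ℂ} (hz : z ∈ polydisk n) (v : Fin n → ℂ) :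
    ‖weighted z (schwarzianOp P z v)‖ ≤ √2 * α * ‖weighted z v‖ ^ 2 := by
  have h2 : (0 : ℝ) < √2 := by positivity
  have hunit : ∀ v, bergmanNorm z v = 1 → bergmanNorm z (schwarzianOp P z v) ≤ α := by
    intro v hv
    have h : ENNReal.ofReal (bergmanNorm z (schwarzianOp P z v)) ≤ (α : ℝ≥0∞) := by
      refine le_trans ?_ hnorm
      rw [schwarzianNorm]
      exact le_iSup₂_of_le z hz (le_iSup₂_of_le v hv le_rfl)
    rw [← ENNReal.ofReal_coe_nnreal] at h
    exact (ENNReal.ofReal_le_ofReal_iff α.2).1 h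
  by_cases hv : v = 0
  · have : schwarzianOp P z (0 : Fin n → ℂ) = 0 := by funext k; simp [schwarzianOp]
    rw [hv, this]
    simp
  · have hN : 0 < bergmanNorm z v := by
      rw [bergmanNorm_eq]
      have : 0 < ‖weighted z v‖ := norm_pos_iff.2 fun h => hv (weighted_eq_zero hz h)
      positivity
    set N := bergmanNorm z v with hNdef
    have h1 := hunit (((N⁻¹ : ℝ) : ℂ) • v) (by
      rw [bergmanNorm_eq, map_smul, norm_smul, Complex.norm_real, Real.norm_of_nonneg (by positivity),
        mul_left_comm, ← bergmanNorm_eq, ← hNdef, inv_mul_cancel₀ hN.ne'])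
    rw [schwarzianOp_smul, bergmanNorm_eq, map_smul, norm_smul, norm_pow, Complex.norm_real,
      Real.norm_of_nonneg (by positivity)] at h1
    have h3 : √2 * ‖weighted z (schwarzianOp P z v)‖ ≤ α * N ^ 2 := by
      have : √2 * (N⁻¹ ^ 2 * ‖weighted z (schwarzianOp P z v)‖) =
          √2 * ‖weighted z (schwarzianOp P z v)‖ / N ^ 2 := by field_simp
      rw [this, div_le_iff₀ (by positivity)] at h1
      exact h1
    rw [hNdef, bergmanNorm_eq] at h3
    have h4 : √2 * ‖weighted z (schwarzianOp P z v)‖ ≤ √2 * (√2 * α * ‖weighted z v‖ ^ 2) := by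
      refine h3.trans_eq ?_
      ring
    exact le_of_mul_le_mul_left h4 h2

/-- In a Hilbert space a symmetric bilinear map has the norm of its quadratic form: polarization and
the parallelogram law bound it by the mean of the squared norms, and normalising both vectors turns
the mean into a product. -/
theorem norm_weighted_bilinOp_le {z : Fin n → ℂ} {β : ℝ} (hz : z ∈ polydisk n)
    (hsymm : ∀ k i j, P k i j z = P k j i z)
    (hS : ∀ v, ‖weighted z (schwarzianOp P z v)‖ ≤ β * ‖weighted z v‖ ^ 2) (v w : Fin n → ℂ) :
    ‖weighted z (bilinOp P z v w)‖ ≤ β * ‖weighted z v‖ * ‖weighted z w‖ := by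
  have hpol : ∀ v w, (4 : ℂ) • bilinOp P z v w =
      schwarzianOp P z (v + w) - schwarzianOp P z (v - w) := by
    intro v w
    funext k
    have h1 : ∑ i, ∑ j, w i * P k i j z * v j = ∑ i, ∑ j, v i * P k i j z * w j := by
      rw [Finset.sum_comm]
      refine Finset.sum_congr rfl fun i _ => Finset.sum_congr rfl fun j _ => ?_
      rw [hsymm k j i]; ring
    have h2 : ∀ s : ℂ, ∑ i, ∑ j, (v i + s * w i) * P k i j z * (v j + s * w j) =
        ∑ i, ∑ j, v i * P k i j z * v j + s * ∑ i, ∑ j, v i * P k i j z * w j +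
          s * ∑ i, ∑ j, w i * P k i j z * v j + s ^ 2 * ∑ i, ∑ j, w i * P k i j z * w j := by
      intro s
      simp only [Finset.mul_sum, ← Finset.sum_add_distrib]
      exact Finset.sum_congr rfl fun _ _ => Finset.sum_congr rfl fun _ _ => by ring
    have h3 := h2 1
    have h4 := h2 (-1)
    simp only [one_mul, neg_one_mul, ← sub_eq_add_neg] at h3 h4
    simp only [bilinOp, schwarzianOp, Pi.smul_apply, Pi.sub_apply, Pi.add_apply, smul_eq_mul]
    rw [h3, h4, h1]
    ring
  have hmean : ∀ v w, 2 * ‖weighted z (bilinOp P z v w)‖ ≤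
      β * (‖weighted z v‖ ^ 2 + ‖weighted z w‖ ^ 2) := by
    intro v w
    have h1 : ‖weighted z ((4 : ℂ) • bilinOp P z v w)‖ ≤
        β * ‖weighted z (v + w)‖ ^ 2 + β * ‖weighted z (v - w)‖ ^ 2 := by
      rw [hpol, map_sub]
      exact (norm_sub_le _ _).trans (add_le_add (hS _) (hS _))
    have h2 := parallelogram_law_with_norm ℂ (weighted z v) (weighted z w)
    rw [map_smul, norm_smul, Complex.norm_ofNat, map_add, map_sub, ← mul_add, h2] at h1
    linarith
  rcases eq_or_ne v 0 with rfl | hv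
  · have : bilinOp P z 0 w = 0 := by funext k; simp [bilinOp]
    simp [this]
  rcases eq_or_ne w 0 with rfl | hw
  · have : bilinOp P z v 0 = 0 := by funext k; simp [bilinOp]
    simp [this]
  have ha : 0 < ‖weighted z v‖ := norm_pos_iff.2 fun h => hv (weighted_eq_zero hz h)
  have hb : 0 < ‖weighted z w‖ := norm_pos_iff.2 fun h => hw (weighted_eq_zero hz h)
  have h := hmean (((‖weighted z v‖⁻¹ : ℝ) : ℂ) • v) (((‖weighted z w‖⁻¹ : ℝ) : ℂ) • w)
  rw [bilinOp_smul_smul, map_smul, map_smul, map_smul, norm_smul, norm_smul, norm_smul, norm_mul,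
    Complex.norm_real, Complex.norm_real, Real.norm_of_nonneg (by positivity),
    Real.norm_of_nonneg (by positivity), inv_mul_cancel₀ ha.ne', inv_mul_cancel₀ hb.ne'] at h
  have h5 : ‖weighted z v‖⁻¹ * ‖weighted z w‖⁻¹ * ‖weighted z (bilinOp P z v w)‖ =
      ‖weighted z (bilinOp P z v w)‖ / (‖weighted z v‖ * ‖weighted z w‖) := by field_simp
  rw [h5] at h
  have h6 : ‖weighted z (bilinOp P z v w)‖ / (‖weighted z v‖ * ‖weighted z w‖) ≤ β := by linarith
  rw [div_le_iff₀ (by positivity)] at h6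
  rwa [mul_assoc]

theorem weighted_single (z : Fin n → ℂ) (i : Fin n) (c : ℂ) :
    weighted z (Pi.single i c) = EuclideanSpace.single i ((((1 - ‖z i‖ ^ 2 : ℝ) : ℂ))⁻¹ * c) := by
  ext j
  rw [weighted_apply]
  by_cases h : j = i
  · subst h; simp
  · simp [h]

theorem bilinOp_single (z : Fin n → ℂ) (i j k : Fin n) :
    bilinOp P z (Pi.single i 1) (Pi.single j 1) k = P k i j z := by
  simp [bilinOp, Pi.single_apply]

theorem norm_coeff_le {z : Fin n → ℂ} {β : ℝ} (hz : z ∈ polydisk n)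
    (hB : ∀ v w, ‖weighted z (bilinOp P z v w)‖ ≤ β * ‖weighted z v‖ * ‖weighted z w‖)
    (k i j : Fin n) :
    ‖P k i j z‖ ≤ β * (1 - ‖z k‖ ^ 2) / ((1 - ‖z i‖ ^ 2) * (1 - ‖z j‖ ^ 2)) := by
  have h1 := (PiLp.norm_apply_le (weighted z (bilinOp P z (Pi.single i 1) (Pi.single j 1))) k).trans
    (hB _ _)
  have hk := one_sub_sq_pos hz k
  have hi := one_sub_sq_pos hz i
  have hj := one_sub_sq_pos hz j
  rw [weighted_apply, bilinOp_single, weighted_single, weighted_single, norm_mul, norm_inv,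
    PiLp.norm_single, PiLp.norm_single, mul_one, mul_one, norm_inv, norm_inv,
    Complex.norm_real, Complex.norm_real, Complex.norm_real, Real.norm_of_nonneg hk.le,
    Real.norm_of_nonneg hi.le, Real.norm_of_nonneg hj.le, inv_mul_le_iff₀ hk] at h1
  refine h1.trans_eq ?_
  field_simp

/-! ### Vanishing coefficients and bounds for their derivatives -/

theorem update_mem_polydisk {z : Fin n → ℂ} (hz : z ∈ polydisk n) (i : Fin n) {t : ℂ}
    (ht : ‖t‖ < 1) : Function.update z i t ∈ polydisk n := by
  intro j
  by_cases h : j = i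
  · subst h; simpa using ht
  · rw [Function.update_of_ne h]; exact hz j

/-- The coefficients `P^k_ij` with `k ∉ {i, j}` tend to zero as `|z_k| → 1`, hence vanish. -/
theorem coeff_eq_zero (hP : HolomorphicCoeffs P P₀) {β : ℝ}
    (hcoeff : ∀ z ∈ polydisk n, ∀ k i j,
      ‖P k i j z‖ ≤ β * (1 - ‖z k‖ ^ 2) / ((1 - ‖z i‖ ^ 2) * (1 - ‖z j‖ ^ 2)))
    {z : Fin n → ℂ} (hz : z ∈ polydisk n) {k i j : Fin n} (hi : i ≠ k) (hj : j ≠ k) :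
    P k i j z = 0 := by
  have hR : ∀ R ∈ Set.Ioo ‖z k‖ 1, ‖P k i j z‖ ≤
      β * (1 - R ^ 2) / ((1 - ‖z i‖ ^ 2) * (1 - ‖z j‖ ^ 2)) := by
    intro R hR
    have hR0 : 0 < R := (norm_nonneg _).trans_lt hR.1
    have hd : DifferentiableOn ℂ (fun τ => P k i j (Function.update z k τ))
        (Metric.closedBall (0 : ℂ) R) := fun τ hτ =>
      (hasDerivAt_comp_update k (hP.1 k i j _ (update_mem_polydisk hz k
        ((mem_closedBall_zero_iff.1 hτ).trans_lt hR.2)))).differentiableAt.differentiableWithinAt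
    have := Complex.norm_le_of_forall_mem_frontier_norm_le (Metric.isBounded_ball (x := (0 : ℂ))
        (r := R)) (f := fun τ => P k i j (Function.update z k τ))
        (C := β * (1 - R ^ 2) / ((1 - ‖z i‖ ^ 2) * (1 - ‖z j‖ ^ 2)))
        (hd.diffContOnCl_ball subset_rfl) ?_ (z := z k) ?_
    · simpa using this
    · intro τ hτ
      rw [frontier_ball _ hR0.ne', mem_sphere_zero_iff_norm] at hτ
      have := hcoeff _ (update_mem_polydisk hz k (hτ.trans_lt hR.2)) k i j
      rwa [Function.update_self, Function.update_of_ne hi, Function.update_of_ne hj, hτ] at this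
    · rw [closure_ball _ hR0.ne']; simpa using hR.1.le
  have hlim : Filter.Tendsto
      (fun R : ℝ => β * (1 - R ^ 2) / ((1 - ‖z i‖ ^ 2) * (1 - ‖z j‖ ^ 2)))
      (nhdsWithin 1 (Set.Iio 1)) (nhds (β * (1 - 1 ^ 2) / ((1 - ‖z i‖ ^ 2) * (1 - ‖z j‖ ^ 2)))) :=
    (Continuous.tendsto (by fun_prop) 1).mono_left nhdsWithin_le_nhds
  have h0 : ‖P k i j z‖ ≤ β * (1 - 1 ^ 2) / ((1 - ‖z i‖ ^ 2) * (1 - ‖z j‖ ^ 2)) := by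
    refine ge_of_tendsto hlim ?_
    filter_upwards [Ioo_mem_nhdsLT (hz k)] with R h using hR R h
  simpa using h0

/-- The weights in $z_i$ cancel in the bound for $P^i_{ij}$, so it is a bounded function of $z_i$
and Schwarz–Pick applies. -/
theorem norm_pd_coeff_le (hP : HolomorphicCoeffs P P₀) {β : ℝ}
    (hcoeff : ∀ z ∈ polydisk n, ∀ k i j,
      ‖P k i j z‖ ≤ β * (1 - ‖z k‖ ^ 2) / ((1 - ‖z i‖ ^ 2) * (1 - ‖z j‖ ^ 2)))
    {z : Fin n → ℂ} (hz : z ∈ polydisk n) {i j : Fin n} (hij : j ≠ i) :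
    ‖pd i (P i i j) z‖ ≤ β / (1 - ‖z j‖ ^ 2) / (1 - ‖z i‖ ^ 2) := by
  have hd : ∀ t : ℂ, ‖t‖ < 1 → HasDerivAt (fun τ => P i i j (Function.update z i τ))
      (pd i (P i i j) (Function.update z i t)) t := fun t ht =>
    hasDerivAt_comp_update i (hP.1 i i j _ (update_mem_polydisk hz i ht))
  have := norm_deriv_le_of_norm_le (fun t ht => (hd t ht).differentiableAt)
    (K := β / (1 - ‖z j‖ ^ 2)) (fun t ht => ?_) (hz i)
  · rwa [(hd _ (hz i)).deriv, Function.update_eq_self] at this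
  · have h1 := hcoeff _ (update_mem_polydisk hz i ht) i i j
    rw [Function.update_self, Function.update_of_ne hij] at h1
    refine h1.trans_eq ?_
    have h2 : 1 - ‖t‖ ^ 2 ≠ 0 := by nlinarith [norm_nonneg t]
    have h3 := (one_sub_sq_pos hz j).ne'
    field_simp

/-- Here one weight in $z_i$ remains, so the estimate with constant $10/3$ is the applicable one. -/
theorem norm_pd_coeff_diag_le (hP : HolomorphicCoeffs P P₀) {K : ℝ}
    (hK : ∀ z ∈ polydisk n, ∀ i, ‖P i i i z‖ ≤ K / (1 - ‖z i‖ ^ 2))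
    {z : Fin n → ℂ} (hz : z ∈ polydisk n) (i : Fin n) :
    ‖pd i (P i i i) z‖ ≤ 10 / 3 * K / (1 - ‖z i‖ ^ 2) ^ 2 := by
  have hd : ∀ t : ℂ, ‖t‖ < 1 → HasDerivAt (fun τ => P i i i (Function.update z i τ))
      (pd i (P i i i) (Function.update z i t)) t := fun t ht =>
    hasDerivAt_comp_update i (hP.1 i i i _ (update_mem_polydisk hz i ht))
  have := norm_deriv_le_of_norm_le_div (fun t ht => (hd t ht).differentiableAt)
    (K := K) (fun t ht => ?_) (hz i)
  · rwa [(hd _ (hz i)).deriv, Function.update_eq_self] at this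
  · have h1 := hK _ (update_mem_polydisk hz i ht) i
    rwa [Function.update_self] at h1

/-! ### Euclidean bounds on tori and the diagonal in dimension two -/

/-- On a torus the weighted norms are multiples of the Euclidean norm. -/
theorem norm_bilinOp_le_of_torus {z : Fin n → ℂ} {β r : ℝ} (hr1 : r < 1) (hr : 0 ≤ r)
    (hzr : ∀ i, ‖z i‖ = r)
    (hB : ∀ v w, ‖weighted z (bilinOp P z v w)‖ ≤ β * ‖weighted z v‖ * ‖weighted z w‖)
    (v w : Fin n → ℂ) :
    ‖WithLp.toLp 2 (bilinOp P z v w)‖ ≤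
      β / (1 - r ^ 2) * ‖WithLp.toLp 2 v‖ * ‖WithLp.toLp 2 w‖ := by
  have hl : 0 < 1 - r ^ 2 := by nlinarith
  have h : ∀ v, ‖weighted z v‖ = (1 - r ^ 2)⁻¹ * ‖WithLp.toLp 2 v‖ := by
    intro v
    have : weighted z v = (((1 - r ^ 2 : ℝ) : ℂ))⁻¹ • WithLp.toLp 2 v := by
      ext i
      rw [weighted_apply, hzr]
      rfl
    rw [this, norm_smul, norm_inv, Complex.norm_real, Real.norm_of_nonneg hl.le]
  have h1 := hB v w
  rw [h, h, h, inv_mul_le_iff₀ hl] at h1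
  refine h1.trans_eq ?_
  field_simp

/-- A scalar estimate behind the two-dimensional bound for the diagonal coefficients: the
parallelogram law for the test vectors `(3, ±2)`. -/
theorem norm_le_of_forall_quadratic_le {p β : ℝ} {a b c d : ℂ} (hβ : 0 ≤ β)
    (ha : ‖a‖ = p) (hd : ‖d‖ = p)
    (h : ∀ x y : ℝ, ‖a * x ^ 2 + 2 * b * x * y‖ ^ 2 + ‖c * y ^ 2 + 2 * d * x * y‖ ^ 2 ≤
      (β * (x ^ 2 + y ^ 2)) ^ 2) : p ≤ 13 / 15 * β := by
  -- Averaging over $\pm y$ gives $p^2(x^4+4x^2y^2)\le\beta^2(x^2+y^2)^2$. The best ratio is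
  -- $y^2/x^2=1/2$, with constant $\sqrt3/2$; the pair $(3,2)$ is a rational choice near it, with
  -- $81+144=15^2$ and $9+4=13$.
  have h1 := h 3 2
  have h2 := h 3 (-2)
  have e1 := parallelogram_law_with_norm ℂ (9 * a) (12 * b)
  have e2 := parallelogram_law_with_norm ℂ (4 * c) (12 * d)
  have r1 : a * ((3 : ℝ) : ℂ) ^ 2 + 2 * b * ((3 : ℝ) : ℂ) * ((2 : ℝ) : ℂ) = 9 * a + 12 * b := by
    push_cast; ring
  have r2 : a * ((3 : ℝ) : ℂ) ^ 2 + 2 * b * ((3 : ℝ) : ℂ) * ((-2 : ℝ) : ℂ) = 9 * a - 12 * b := by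
    push_cast; ring
  have r3 : c * ((2 : ℝ) : ℂ) ^ 2 + 2 * d * ((3 : ℝ) : ℂ) * ((2 : ℝ) : ℂ) = 4 * c + 12 * d := by
    push_cast; ring
  have r4 : c * ((-2 : ℝ) : ℂ) ^ 2 + 2 * d * ((3 : ℝ) : ℂ) * ((-2 : ℝ) : ℂ) = 4 * c - 12 * d := by
    push_cast; ring
  rw [r1, r3] at h1
  rw [r2, r4] at h2
  simp only [norm_mul, Complex.norm_ofNat, ha, hd] at e1 e2
  have : (15 * p) ^ 2 ≤ (13 * β) ^ 2 := by nlinarith [sq_nonneg ‖b‖, sq_nonneg ‖c‖]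
  have := abs_le_of_sq_le_sq this (by positivity)
  linarith [le_abs_self (15 * p)]

/-- Canonical form gives $P^m_{mk}=-P^k_{kk}$ for the other index $m$, so the same coefficient
enters both components of the Schwarzian operator. This improves on the constant $1$, which would be
too weak for the numerical condition when $n=2$. -/
theorem norm_coeff_diag_le_of_dim_two {P : Fin 2 → Fin 2 → Fin 2 → (Fin 2 → ℂ) → ℂ} {β : ℝ}
    (hβ : 0 ≤ β) (hcan : CanonicalForm P) {z : Fin 2 → ℂ} (hz : z ∈ polydisk 2)
    (hsymm : ∀ k i j, P k i j z = P k j i z)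
    (hvanish : ∀ k i j, i ≠ k → j ≠ k → P k i j z = 0)
    (hS : ∀ v, ‖weighted z (schwarzianOp P z v)‖ ≤ β * ‖weighted z v‖ ^ 2) (k : Fin 2) :
    ‖P k k k z‖ ≤ 13 / 15 * β / (1 - ‖z k‖ ^ 2) := by
  obtain ⟨m, hm, huniv⟩ : ∃ m : Fin 2, m ≠ k ∧ (Finset.univ : Finset (Fin 2)) = {k, m} := by
    fin_cases k
    · exact ⟨1, by decide, by decide⟩
    · exact ⟨0, by decide, by decide⟩
  have hsum : ∀ {M : Type} [AddCommMonoid M] (f : Fin 2 → M), ∑ i, f i = f k + f m := by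
    intro M _ f
    rw [huniv, Finset.sum_pair hm.symm]
  have hk := one_sub_sq_pos hz k
  have hm' := one_sub_sq_pos hz m
  have hkC : ((1 - ‖z k‖ ^ 2 : ℝ) : ℂ) ≠ 0 := Complex.ofReal_ne_zero.2 hk.ne'
  have hmC : ((1 - ‖z m‖ ^ 2 : ℝ) : ℂ) ≠ 0 := Complex.ofReal_ne_zero.2 hm'.ne'
  set lk := 1 - ‖z k‖ ^ 2 with hlk
  set lm := 1 - ‖z m‖ ^ 2 with hlm
  have hmmk : P m m k z = -P k k k z := by
    have := hcan z hz k
    rw [hsum, hsymm m k m] at this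
    linear_combination this
  rw [le_div_iff₀ hk]
  refine norm_le_of_forall_quadratic_le (a := P k k k z * lk) (b := P k k m z * lm)
    (c := P m m m z * lm) (d := -P k k k z * lk) hβ ?_ ?_ fun x y => ?_
  · rw [norm_mul, Complex.norm_real, Real.norm_of_nonneg hk.le]
  · rw [norm_mul, norm_neg, Complex.norm_real, Real.norm_of_nonneg hk.le]
  · set v : Fin 2 → ℂ := fun i => if i = k then (lk : ℂ) * x else (lm : ℂ) * y with hv
    have hvk : v k = (lk : ℂ) * x := by simp [hv]
    have hvm : v m = (lm : ℂ) * y := by simp [hv, hm]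
    have h1 : ‖weighted z v‖ ^ 2 = x ^ 2 + y ^ 2 := by
      rw [EuclideanSpace.norm_sq_eq, hsum, weighted_apply, weighted_apply, hvk, hvm, ← hlk, ← hlm,
        inv_mul_cancel_left₀ hkC, inv_mul_cancel_left₀ hmC]
      simp
    have h2 : ‖weighted z (schwarzianOp P z v)‖ ^ 2 ≤ (β * (x ^ 2 + y ^ 2)) ^ 2 := by
      rw [← h1]
      exact pow_le_pow_left₀ (norm_nonneg _) (hS v) 2
    refine le_trans (le_of_eq ?_) h2
    rw [EuclideanSpace.norm_sq_eq, hsum, weighted_apply, weighted_apply, ← hlk, ← hlm]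
    have ek : schwarzianOp P z v k =
        lk * (P k k k z * lk * x ^ 2 + 2 * (P k k m z * lm) * x * y) := by
      simp only [schwarzianOp, hsum, hvk, hvm, hvanish k m m hm hm, hsymm k m k]
      ring
    have em : schwarzianOp P z v m =
        lm * (P m m m z * lm * y ^ 2 + 2 * (-P k k k z * lk) * x * y) := by
      simp only [schwarzianOp, hsum, hvk, hvm, hvanish m k k hm.symm hm.symm, hsymm m k m, hmmk]
      ring
    rw [ek, em, inv_mul_cancel_left₀ hkC, inv_mul_cancel_left₀ hmC]

/-! ### Bound for P⁰ on a torus -/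

theorem norm_sum_sum_mul_le {ι : Type*} [Fintype ι] (a b : ι → ι → ℂ) {A B : ℝ} (hA : 0 ≤ A)
    (ha : ∑ k, ∑ l, ‖a k l‖ ^ 2 ≤ A ^ 2) (hb : ∑ k, ∑ l, ‖b k l‖ ^ 2 ≤ B ^ 2) (hB : 0 ≤ B) :
    ‖∑ k, ∑ l, a k l * b k l‖ ≤ A * B := by
  have h1 : ‖∑ k, ∑ l, a k l * b k l‖ ≤ ∑ p : ι × ι, ‖a p.1 p.2‖ * ‖b p.1 p.2‖ := by
    rw [Fintype.sum_prod_type]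
    refine norm_sum_le_of_le _ fun k _ => norm_sum_le_of_le _ fun l _ => ?_
    rw [norm_mul]
  have h2 := Finset.sum_mul_sq_le_sq_mul_sq Finset.univ (fun p : ι × ι => ‖a p.1 p.2‖)
    fun p => ‖b p.1 p.2‖
  rw [Fintype.sum_prod_type (fun p : ι × ι => ‖a p.1 p.2‖ ^ 2),
    Fintype.sum_prod_type (fun p : ι × ι => ‖b p.1 p.2‖ ^ 2)] at h2
  refine h1.trans ((le_abs_self _).trans (abs_le_of_sq_le_sq (h2.trans ?_) (by positivity)))
  rw [mul_pow]
  exact mul_le_mul ha hb (by positivity) (by positivity)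

/-- The bound for `P⁰(ζ, ·)` at a point of a torus `|z_i| = r`, for a unimodular vector `ζ`. -/
theorem norm_coeff_zero_le_of_torus (hP : HolomorphicCoeffs P P₀)
    (hint : CompletelyIntegrable P P₀) (hcan : CanonicalForm P) {β K r : ℝ} (hβ : 0 ≤ β)
    (hB : ∀ z ∈ polydisk n, ∀ v w,
      ‖weighted z (bilinOp P z v w)‖ ≤ β * ‖weighted z v‖ * ‖weighted z w‖)
    (hK : ∀ z ∈ polydisk n, ∀ i, ‖P i i i z‖ ≤ K / (1 - ‖z i‖ ^ 2))
    {z ζ : Fin n → ℂ} (hr : 0 ≤ r) (hr1 : r < 1) (hzr : ∀ i, ‖z i‖ = r) (hζ : ∀ i, ‖ζ i‖ = 1)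
    (hn : 1 ≤ n) (j : Fin n) :
    ((n : ℝ) - 1) * ‖∑ i, ζ i * P₀ i j z‖ ≤
      (n * √n * β ^ 2 + 10 / 3 * K + 2 * (n - 1) * β) / (1 - r ^ 2) ^ 2 := by
  have hz : z ∈ polydisk n := fun i => (hzr i).trans_lt hr1
  have hl : 0 < 1 - r ^ 2 := by nlinarith
  have hn1 : (0 : ℝ) ≤ (n : ℝ) - 1 := by
    have : (1 : ℝ) ≤ n := by exact_mod_cast hn
    linarith
  have hcoeff : ∀ z ∈ polydisk n, ∀ k i j,
      ‖P k i j z‖ ≤ β * (1 - ‖z k‖ ^ 2) / ((1 - ‖z i‖ ^ 2) * (1 - ‖z j‖ ^ 2)) :=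
    fun z hz => norm_coeff_le hz (hB z hz)
  have hB' := norm_bilinOp_le_of_torus hr1 hr hzr (hB z hz)
  have hrow : ∀ v w : Fin n → ℂ, ∑ k, ‖bilinOp P z v w k‖ ^ 2 ≤
      (β / (1 - r ^ 2)) ^ 2 * (‖WithLp.toLp 2 v‖ ^ 2 * ‖WithLp.toLp 2 w‖ ^ 2) := by
    intro v w
    have := pow_le_pow_left₀ (norm_nonneg _) (hB' v w) 2
    rw [EuclideanSpace.norm_sq_eq] at this
    refine this.trans_eq ?_
    ring
  have hsingle : ∀ i : Fin n,
      ‖(WithLp.toLp 2 (Pi.single i 1 : Fin n → ℂ) : EuclideanSpace ℂ (Fin n))‖ ^ 2 = 1 := by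
    intro i
    rw [EuclideanSpace.norm_sq_eq]
    simp [Pi.single_apply, apply_ite norm]
  have hζn : ‖(WithLp.toLp 2 ζ : EuclideanSpace ℂ (Fin n))‖ ^ 2 = n := by
    rw [EuclideanSpace.norm_sq_eq]
    simp [hζ]
  -- the quadratic term
  have hquad : ‖∑ k, ∑ l, P k l j z * ∑ i, ζ i * P l i k z‖ ≤
      n * √n * β ^ 2 / (1 - r ^ 2) ^ 2 := by
    -- Hilbert–Schmidt norms, with $b=\beta/(1-r^2)$: the $n$ columns $B(e_l,e_j)$ have norm at most
    -- $b$, and the $n$ columns $B(\zeta,e_k)$ at most $b\sqrt n$.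
    have := norm_sum_sum_mul_le (fun k l => P k l j z) (fun k l => ∑ i, ζ i * P l i k z)
      (A := √n * (β / (1 - r ^ 2))) (B := n * (β / (1 - r ^ 2))) (by positivity) ?_ ?_
      (by positivity)
    · refine this.trans_eq ?_
      field_simp
    · rw [Finset.sum_comm, mul_pow, Real.sq_sqrt (Nat.cast_nonneg n)]
      calc ∑ l, ∑ k, ‖P k l j z‖ ^ 2 ≤ ∑ l : Fin n, (β / (1 - r ^ 2)) ^ 2 := by
            refine Finset.sum_le_sum fun l _ => ?_
            have := hrow (Pi.single l 1) (Pi.single j 1)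
            simpa only [bilinOp_single, hsingle, mul_one] using this
        _ = n * (β / (1 - r ^ 2)) ^ 2 := by simp
    · calc ∑ k, ∑ l, ‖∑ i, ζ i * P l i k z‖ ^ 2 ≤
            ∑ k : Fin n, (β / (1 - r ^ 2)) ^ 2 * n := by
            refine Finset.sum_le_sum fun k _ => ?_
            have := hrow ζ (Pi.single k 1)
            rw [hsingle, hζn, mul_one] at this
            refine le_trans (le_of_eq (Finset.sum_congr rfl fun l _ => ?_)) this
            simp [bilinOp, Pi.single_apply]
        _ = (n * (β / (1 - r ^ 2))) ^ 2 := by simp; ring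
  -- the divergence term
  have hdiv : ∀ i, ‖∑ l, pd l (P l i j) z‖ ≤
      (2 * β + if i = j then 10 / 3 * K - 2 * β else 0) / (1 - r ^ 2) ^ 2 := by
    intro i
    -- Only $l=i$ and $l=j$ contribute to the divergence.
    have h0 : ∀ l, l ≠ i → l ≠ j → pd l (P l i j) z = 0 := by
      intro l hi hj
      rw [pd_congr (isOpen_polydisk n) (g := fun _ => 0)
        (fun x hx => coeff_eq_zero hP hcoeff hx hi.symm hj.symm) hz, pd_const]
    by_cases hij : i = j
    · subst hij
      rw [Finset.sum_eq_single i (fun l _ hl => h0 l hl hl) (by simp)]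
      have := norm_pd_coeff_diag_le hP hK hz i
      rw [hzr] at this
      refine this.trans_eq ?_
      simp
    · rw [Fintype.sum_eq_add i j hij fun l hl => h0 l hl.1 hl.2,
        pd_congr (isOpen_polydisk n) (fun x hx => hint.coeff_symm hP hx j i j) hz j]
      have h1 := norm_pd_coeff_le hP hcoeff hz (Ne.symm hij)
      have h2 := norm_pd_coeff_le hP hcoeff hz hij
      rw [hzr, hzr] at h1 h2
      refine (norm_add_le _ _).trans ((add_le_add h1 h2).trans_eq ?_)
      simp only [hij, if_false]
      field_simp
      ring
  have hrepr : ((n : ℂ) - 1) * ∑ i, ζ i * P₀ i j z =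
      ∑ k, ∑ l, P k l j z * ∑ i, ζ i * P l i k z - ∑ i, ζ i * ∑ l, pd l (P l i j) z := by
    have h1 : ∀ i, ((n : ℂ) - 1) * (ζ i * P₀ i j z) =
        ∑ k, ∑ l, P k l j z * (ζ i * P l i k z) - ζ i * ∑ l, pd l (P l i j) z := by
      intro i
      rw [mul_left_comm, hint.coeff_zero_eq hP hcan hz i j, mul_sub, Finset.mul_sum]
      congr 1
      refine Finset.sum_congr rfl fun k _ => ?_
      rw [Finset.mul_sum]
      exact Finset.sum_congr rfl fun l _ => by ring
    rw [Finset.mul_sum, Finset.sum_congr rfl fun i _ => h1 i, Finset.sum_sub_distrib,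
      Finset.sum_comm]
    congr 1
    refine Finset.sum_congr rfl fun k _ => ?_
    rw [Finset.sum_comm]
    exact Finset.sum_congr rfl fun l _ => by rw [Finset.mul_sum]
  have hnorm : ((n : ℝ) - 1) * ‖∑ i, ζ i * P₀ i j z‖ = ‖((n : ℂ) - 1) * ∑ i, ζ i * P₀ i j z‖ := by
    rw [norm_mul]
    congr 1
    rw [show (n : ℂ) - 1 = (((n : ℝ) - 1 : ℝ) : ℂ) by push_cast; rfl, Complex.norm_real,
      Real.norm_of_nonneg hn1]
  rw [hnorm, hrepr]
  have hdiv' : ‖∑ i, ζ i * ∑ l, pd l (P l i j) z‖ ≤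
      (10 / 3 * K + 2 * (n - 1) * β) / (1 - r ^ 2) ^ 2 := by
    calc ‖∑ i, ζ i * ∑ l, pd l (P l i j) z‖
        ≤ ∑ i, (2 * β + if i = j then 10 / 3 * K - 2 * β else 0) / (1 - r ^ 2) ^ 2 := by
          refine norm_sum_le_of_le _ fun i _ => ?_
          rw [norm_mul, hζ, one_mul]
          exact hdiv i
      _ = (10 / 3 * K + 2 * (n - 1) * β) / (1 - r ^ 2) ^ 2 := by
          rw [← Finset.sum_div, Finset.sum_add_distrib, Finset.sum_ite_eq' Finset.univ j]
          simp
          ring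
  refine (norm_sub_le _ _).trans ((add_le_add hquad hdiv').trans_eq ?_)
  ring

/-! ### Riccati comparison along rays -/

theorem norm_sum_mul_le_norm_mul_norm (a b : Fin n → ℂ) :
    ‖∑ k, a k * b k‖ ≤ ‖(WithLp.toLp 2 a : EuclideanSpace ℂ (Fin n))‖ *
      ‖(WithLp.toLp 2 b : EuclideanSpace ℂ (Fin n))‖ := by
  have h1 : ‖∑ k, a k * b k‖ ≤ ∑ k, ‖a k‖ * ‖b k‖ :=
    norm_sum_le_of_le _ fun k _ => (norm_mul _ _).le
  have h2 := Finset.sum_mul_sq_le_sq_mul_sq Finset.univ (fun k => ‖a k‖) fun k => ‖b k‖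
  refine h1.trans ((le_abs_self _).trans (abs_le_of_sq_le_sq (h2.trans_eq ?_) (by positivity)))
  rw [mul_pow, EuclideanSpace.norm_sq_eq, EuclideanSpace.norm_sq_eq]

theorem norm_toLp_le_sqrt_mul {a : Fin n → ℂ} {C : ℝ} (h : ∀ j, ‖a j‖ ≤ C) (hC : 0 ≤ C) :
    ‖(WithLp.toLp 2 a : EuclideanSpace ℂ (Fin n))‖ ≤ √n * C := by
  rw [EuclideanSpace.norm_eq]
  refine Real.sqrt_le_iff.2 ⟨by positivity, ?_⟩
  calc ∑ j, ‖a j‖ ^ 2 ≤ ∑ _j : Fin n, C ^ 2 :=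
        Finset.sum_le_sum fun j _ => pow_le_pow_left₀ (norm_nonneg _) (h j) 2
    _ = (√n * C) ^ 2 := by rw [mul_pow, Real.sq_sqrt (Nat.cast_nonneg n)]; simp

theorem norm_toLp_unimodular {ζ : Fin n → ℂ} (hζ : ∀ i, ‖ζ i‖ = 1) :
    ‖(WithLp.toLp 2 ζ : EuclideanSpace ℂ (Fin n))‖ = √n := by
  rw [EuclideanSpace.norm_eq]
  simp [hζ]

/-- The transpose of `B(ζ, ·)` has the same norm as `B(ζ, ·)`. -/
theorem norm_transpose_bilinOp_le {z : Fin n → ℂ} {b : ℝ} (hb : 0 ≤ b)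
    (hB : ∀ v w : Fin n → ℂ, ‖WithLp.toLp 2 (bilinOp P z v w)‖ ≤
      b * ‖WithLp.toLp 2 v‖ * ‖WithLp.toLp 2 w‖) (ζ y : Fin n → ℂ) :
    ‖(WithLp.toLp 2 fun j => ∑ i, ζ i * ∑ k, P k i j z * y k : EuclideanSpace ℂ (Fin n))‖ ≤
      b * ‖(WithLp.toLp 2 ζ : EuclideanSpace ℂ (Fin n))‖ *
        ‖(WithLp.toLp 2 y : EuclideanSpace ℂ (Fin n))‖ := by
  set T : Fin n → ℂ := fun j => ∑ i, ζ i * ∑ k, P k i j z * y k with hT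
  set c : Fin n → ℂ := fun j => (starRingEnd ℂ) (T j) with hc
  have hcn : ‖(WithLp.toLp 2 c : EuclideanSpace ℂ (Fin n))‖ =
      ‖(WithLp.toLp 2 T : EuclideanSpace ℂ (Fin n))‖ := by
    rw [EuclideanSpace.norm_eq, EuclideanSpace.norm_eq]
    simp [hc]
  -- Duality: pairing $T$ with its conjugate $c$ moves the transpose back to $B(\zeta,c)$.
  have h1 : ((‖(WithLp.toLp 2 T : EuclideanSpace ℂ (Fin n))‖ ^ 2 : ℝ) : ℂ) =
      ∑ k, y k * bilinOp P z ζ c k := by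
    rw [EuclideanSpace.norm_sq_eq]
    push_cast
    have h2 : ∀ j, ((‖T j‖ : ℂ)) ^ 2 = T j * c j := by
      intro j
      rw [hc, Complex.mul_conj, Complex.normSq_eq_norm_sq]
      push_cast; rfl
    calc ∑ j, ((‖T j‖ : ℂ)) ^ 2 = ∑ j, ∑ i, ∑ k, y k * (ζ i * P k i j z * c j) := by
          refine Finset.sum_congr rfl fun j _ => ?_
          rw [h2, hT, Finset.sum_mul]
          refine Finset.sum_congr rfl fun i _ => ?_
          rw [Finset.mul_sum, Finset.sum_mul]
          exact Finset.sum_congr rfl fun k _ => by ring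
      _ = ∑ k, y k * bilinOp P z ζ c k := by
          rw [Finset.sum_congr rfl fun j _ => Finset.sum_comm, Finset.sum_comm]
          refine Finset.sum_congr rfl fun k _ => ?_
          rw [bilinOp, Finset.sum_comm]
          simp only [Finset.mul_sum]
  have h3 : ‖(WithLp.toLp 2 T : EuclideanSpace ℂ (Fin n))‖ ^ 2 ≤
      ‖(WithLp.toLp 2 y : EuclideanSpace ℂ (Fin n))‖ * (b *
        ‖(WithLp.toLp 2 ζ : EuclideanSpace ℂ (Fin n))‖ *
          ‖(WithLp.toLp 2 T : EuclideanSpace ℂ (Fin n))‖) := by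
    have h4 := norm_sum_mul_le_norm_mul_norm y (bilinOp P z ζ c)
    rw [← h1, Complex.norm_real, Real.norm_of_nonneg (by positivity)] at h4
    refine h4.trans (mul_le_mul_of_nonneg_left ?_ (norm_nonneg _))
    have h5 := hB ζ c
    rw [hcn] at h5
    exact h5
  rcases (norm_nonneg (WithLp.toLp 2 T : EuclideanSpace ℂ (Fin n))).eq_or_lt with h0 | h0
  · rw [← h0]; positivity
  · refine le_of_mul_le_mul_right ?_ h0
    nlinarith

/-- The Riccati equation along a ray for the logarithmic gradient of a solution. -/
theorem hasDerivAt_logGrad {u : (Fin n → ℂ) → ℂ} (hu : IsSolution P P₀ u) (ζ : Fin n → ℂ) {t : ℝ}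
    (ht : (t : ℂ) • ζ ∈ polydisk n) (h0 : u ((t : ℂ) • ζ) ≠ 0) :
    HasDerivAt (fun s : ℝ => (u ((s : ℂ) • ζ))⁻¹ • grad u ((s : ℂ) • ζ))
      ((WithLp.toLp 2 fun j => ∑ i, ζ i * ∑ k, P k i j ((t : ℂ) • ζ) *
          ((u ((t : ℂ) • ζ))⁻¹ • grad u ((t : ℂ) • ζ)) k) +
        (WithLp.toLp 2 fun j => ∑ i, ζ i * P₀ i j ((t : ℂ) • ζ)) -
        (∑ i, ζ i * ((u ((t : ℂ) • ζ))⁻¹ • grad u ((t : ℂ) • ζ)) i) •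
          ((u ((t : ℂ) • ζ))⁻¹ • grad u ((t : ℂ) • ζ))) t := by
  have hline : ∀ {f : (Fin n → ℂ) → ℂ}, AnalyticOnNhd ℂ f (polydisk n) →
      HasDerivAt (fun s : ℝ => f ((s : ℂ) • ζ)) (∑ i, ζ i * pd i f ((t : ℂ) • ζ)) t := by
    intro f hf
    have := hasDerivAt_line (f := f) 0 ζ (t := t) (by rw [zero_add]; exact hf _ ht)
    simpa only [zero_add] using this
  have hinv := (hline hu.1).fun_inv h0
  have hcomp := hasDerivAt_pi.2 fun j => hinv.fun_mul (hline (analyticOnNhd_pd hu.1 j))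
  have hlp := (PiLp.hasFDerivAt_toLp (𝕜 := ℝ) (E := fun _ : Fin n => ℂ) 2
    (fun j : Fin n => (u ((t : ℂ) • ζ))⁻¹ * pd j u ((t : ℂ) • ζ))).comp_hasDerivAt t hcomp
  refine HasDerivAt.congr_deriv (f := fun s : ℝ => (u ((s : ℂ) • ζ))⁻¹ • grad u ((s : ℂ) • ζ))
    hlp ?_
  ext j
  change -(∑ i, ζ i * pd i u ((t : ℂ) • ζ)) / u ((t : ℂ) • ζ) ^ 2 * pd j u ((t : ℂ) • ζ) +
    (u ((t : ℂ) • ζ))⁻¹ * ∑ i, ζ i * pd i (pd j u) ((t : ℂ) • ζ) = _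
  simp only [grad, PiLp.sub_apply, PiLp.add_apply, PiLp.smul_apply, smul_eq_mul, hu.2 _ ht]
  have e1 : ∑ i, ζ i * ((u ((t : ℂ) • ζ))⁻¹ * pd i u ((t : ℂ) • ζ)) =
      (u ((t : ℂ) • ζ))⁻¹ * ∑ i, ζ i * pd i u ((t : ℂ) • ζ) := by
    rw [Finset.mul_sum]
    exact Finset.sum_congr rfl fun i _ => by ring
  have e2 : (u ((t : ℂ) • ζ))⁻¹ * ∑ i, ζ i * (∑ k, P k i j ((t : ℂ) • ζ) * pd k u ((t : ℂ) • ζ) +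
      P₀ i j ((t : ℂ) • ζ) * u ((t : ℂ) • ζ)) =
      ∑ i, ζ i * ∑ k, P k i j ((t : ℂ) • ζ) * ((u ((t : ℂ) • ζ))⁻¹ * pd k u ((t : ℂ) • ζ)) +
        ∑ i, ζ i * P₀ i j ((t : ℂ) • ζ) := by
    rw [Finset.mul_sum, ← Finset.sum_add_distrib]
    refine Finset.sum_congr rfl fun i _ => ?_
    have : ∑ k, P k i j ((t : ℂ) • ζ) * ((u ((t : ℂ) • ζ))⁻¹ * pd k u ((t : ℂ) • ζ)) =
        (u ((t : ℂ) • ζ))⁻¹ * ∑ k, P k i j ((t : ℂ) • ζ) * pd k u ((t : ℂ) • ζ) := by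
      rw [Finset.mul_sum]
      exact Finset.sum_congr rfl fun k _ => by ring
    rw [this]
    field_simp
  rw [e1, e2]
  field_simp
  ring

/-- The comparison argument along a ray on which the solution has no zeros. -/
theorem norm_logGrad_le_on_ray {u : (Fin n → ℂ) → ℂ} (hu : IsSolution P P₀ u)
    (hgrad0 : grad u 0 = 0) {β D : ℝ} (hn : 1 ≤ n) (hβ : 0 ≤ β) (hD : 0 ≤ D)
    (hβD : β * √n + n * D < 1) {ζ : Fin n → ℂ} (hζ : ∀ i, ‖ζ i‖ = 1) {R : ℝ} (hR : R < 1)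
    (hB : ∀ t : ℝ, 0 ≤ t → t < 1 → ∀ v w : Fin n → ℂ,
      ‖WithLp.toLp 2 (bilinOp P ((t : ℂ) • ζ) v w)‖ ≤
        β / (1 - t ^ 2) * ‖WithLp.toLp 2 v‖ * ‖WithLp.toLp 2 w‖)
    (hP₀ : ∀ t : ℝ, 0 ≤ t → t < 1 → ∀ j,
      ‖∑ i, ζ i * P₀ i j ((t : ℂ) • ζ)‖ ≤ D / (1 - t ^ 2) ^ 2)
    (hne : ∀ t ∈ Set.Icc (0 : ℝ) R, u ((t : ℂ) • ζ) ≠ 0) :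
    ∀ t ∈ Set.Icc (0 : ℝ) R, ‖(u ((t : ℂ) • ζ))⁻¹ • grad u ((t : ℂ) • ζ)‖ ≤
      (√n)⁻¹ * (t / (1 - t ^ 2)) := by
  have hmem : ∀ t ∈ Set.Icc (0 : ℝ) R, (t : ℂ) • ζ ∈ polydisk n := by
    intro t ht i
    rw [Pi.smul_apply, norm_smul, hζ, Complex.norm_real, Real.norm_of_nonneg ht.1, mul_one]
    exact ht.2.trans_lt hR
  have hder := fun t (ht : t ∈ Set.Icc (0 : ℝ) R) => hasDerivAt_logGrad hu ζ (hmem t ht) (hne t ht)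
  have hlpos : ∀ t ∈ Set.Icc (0 : ℝ) R, 0 < 1 - t ^ 2 := fun t ht => by
    nlinarith [ht.1, ht.2]
  have hBd : ∀ t ∈ Set.Icc (0 : ℝ) R, HasDerivAt (fun t : ℝ => (√n)⁻¹ * (t / (1 - t ^ 2)))
      ((√n)⁻¹ * ((1 + t ^ 2) / (1 - t ^ 2) ^ 2)) t := by
    intro t ht
    have h1 : HasDerivAt (fun t : ℝ => 1 - t ^ 2) (-(2 * t)) t := by
      simpa using (hasDerivAt_pow 2 t).const_sub 1
    refine (((hasDerivAt_id' t).fun_div h1 (hlpos t ht).ne').const_mul (√n)⁻¹).congr_deriv ?_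
    ring
  have hs : 0 < √(n : ℝ) := Real.sqrt_pos.2 (by exact_mod_cast hn)
  have hs2 : √(n : ℝ) * √n = n := Real.mul_self_sqrt (Nat.cast_nonneg n)
  -- The strict inequality of derivatives is needed only where $\|Y\|$ equals the barrier.
  refine fun t ht => image_norm_le_of_norm_deriv_right_lt_deriv_boundary'
    (fun t ht => (hder t ht).continuousAt.continuousWithinAt)
    (fun t ht => (hder t ⟨ht.1, ht.2.le⟩).hasDerivWithinAt)
    (B := fun t : ℝ => (√n)⁻¹ * (t / (1 - t ^ 2)))
    (B' := fun t : ℝ => (√n)⁻¹ * ((1 + t ^ 2) / (1 - t ^ 2) ^ 2)) ?_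
    (fun t ht => (hBd t ht).continuousAt.continuousWithinAt)
    (fun t ht => (hBd t ⟨ht.1, ht.2.le⟩).hasDerivWithinAt) ?_ ht
  · simp [hgrad0]
  · intro t ht hY
    have ht' : t ∈ Set.Icc (0 : ℝ) R := ⟨ht.1, ht.2.le⟩
    have ht1 : t < 1 := ht.2.trans hR
    have hl := hlpos t ht'
    set Y := (u ((t : ℂ) • ζ))⁻¹ • grad u ((t : ℂ) • ζ) with hYdef
    have h1 := norm_transpose_bilinOp_le (b := β / (1 - t ^ 2)) (by positivity) (hB t ht.1 ht1) ζ Y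
    have h2 := norm_toLp_le_sqrt_mul (hP₀ t ht.1 ht1) (by positivity)
    have h3 := norm_sum_mul_le_norm_mul_norm ζ Y
    rw [norm_toLp_unimodular hζ] at h1 h3
    have hYY : (WithLp.toLp 2 (WithLp.ofLp Y) : EuclideanSpace ℂ (Fin n)) = Y := rfl
    rw [hYY] at h1 h3
    have h4 := (norm_sub_le _ _).trans (add_le_add ((norm_add_le _ _).trans (add_le_add h1 h2))
      ((norm_smul_le (∑ i, ζ i * Y i) Y).trans (mul_le_mul_of_nonneg_right h3 (norm_nonneg Y))))
    refine h4.trans_lt ?_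
    rw [hY]
    -- At contact the quadratic term contributes exactly the $t^2$ of the barrier's derivative, so
    -- the linear term and $P^0$ have to fit into the remaining $1$.
    have h5 : β / (1 - t ^ 2) * √n * ((√n)⁻¹ * (t / (1 - t ^ 2))) + √n * (D / (1 - t ^ 2) ^ 2) +
        √n * ((√n)⁻¹ * (t / (1 - t ^ 2))) * ((√n)⁻¹ * (t / (1 - t ^ 2))) =
        (√n)⁻¹ * ((β * √n * t + √n * √n * D + t ^ 2) / (1 - t ^ 2) ^ 2) := by
      field_simp
    rw [h5, hs2]
    refine mul_lt_mul_of_pos_left ?_ (inv_pos.2 hs)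
    refine div_lt_div_of_pos_right ?_ (by positivity)
    have : β * √n * t ≤ β * √n := mul_le_of_le_one_right (by positivity) ht1.le
    linarith

/-! ### Absence of zeros -/

/-- The growth bound along a ray that follows from the bound for the logarithmic gradient. -/
theorem one_sub_sq_le_norm_sq_on_ray {u : (Fin n → ℂ) → ℂ}
    (hu : AnalyticOnNhd ℂ u (polydisk n)) (hu0 : u 0 = 1) (hn : 1 ≤ n)
    {ζ : Fin n → ℂ} (hζ : ∀ i, ‖ζ i‖ = 1) {R : ℝ} (hR0 : 0 ≤ R) (hR : R < 1)
    (hne : ∀ t ∈ Set.Icc (0 : ℝ) R, u ((t : ℂ) • ζ) ≠ 0)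
    (hY : ∀ t ∈ Set.Icc (0 : ℝ) R, ‖(u ((t : ℂ) • ζ))⁻¹ • grad u ((t : ℂ) • ζ)‖ ≤
      (√n)⁻¹ * (t / (1 - t ^ 2))) :
    1 - R ^ 2 ≤ ‖u ((R : ℂ) • ζ)‖ ^ 2 := by
  have hmem : ∀ t ∈ Set.Icc (0 : ℝ) R, (t : ℂ) • ζ ∈ polydisk n := by
    intro t ht i
    rw [Pi.smul_apply, norm_smul, hζ, Complex.norm_real, Real.norm_of_nonneg ht.1, mul_one]
    exact ht.2.trans_lt hR
  have hlpos : ∀ t ∈ Set.Icc (0 : ℝ) R, 0 < 1 - t ^ 2 := fun t ht => by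
    nlinarith [ht.1, ht.2]
  have hs : 0 < √(n : ℝ) := Real.sqrt_pos.2 (by exact_mod_cast hn)
  have hg : ∀ t ∈ Set.Icc (0 : ℝ) R, HasDerivAt (fun s : ℝ => u ((s : ℂ) • ζ))
      (∑ i, ζ i * pd i u ((t : ℂ) • ζ)) t := by
    intro t ht
    have := hasDerivAt_line (f := u) 0 ζ (t := t) (by rw [zero_add]; exact hu _ (hmem t ht))
    simpa only [zero_add] using this
  have hd : ∀ t ∈ Set.Icc (0 : ℝ) R, HasDerivAt
      (fun s : ℝ => ‖u ((s : ℂ) • ζ)‖ ^ 2 / (1 - s ^ 2))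
      ((2 * inner ℝ (u ((t : ℂ) • ζ)) (∑ i, ζ i * pd i u ((t : ℂ) • ζ)) * (1 - t ^ 2) -
        ‖u ((t : ℂ) • ζ)‖ ^ 2 * (-(2 * t))) / (1 - t ^ 2) ^ 2) t := by
    intro t ht
    have h1 : HasDerivAt (fun t : ℝ => 1 - t ^ 2) (-(2 * t)) t := by
      simpa using (hasDerivAt_pow 2 t).const_sub 1
    exact (hg t ht).norm_sq.fun_div h1 (hlpos t ht).ne'
  -- The radial derivative of $u$ is $\zeta\cdot\nabla u$, and $|\zeta|=\sqrt n$ cancels the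
  -- $n^{-1/2}$ of the barrier: $|(\log u)'|\le t/(1-t^2)$, while $\tfrac12\log(1-t^2)$ has
  -- derivative $-t/(1-t^2)$.
  have hmono : MonotoneOn (fun s : ℝ => ‖u ((s : ℂ) • ζ)‖ ^ 2 / (1 - s ^ 2)) (Set.Icc 0 R) := by
    refine monotoneOn_of_deriv_nonneg (convex_Icc 0 R)
      (fun t ht => (hd t ht).continuousAt.continuousWithinAt)
      (fun t ht => (hd t (interior_subset ht)).differentiableAt.differentiableWithinAt)
      fun t ht => ?_
    have ht' := interior_subset ht
    rw [(hd t ht').deriv]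
    refine div_nonneg ?_ (by positivity)
    have hl := hlpos t ht'
    have h1 : ‖∑ i, ζ i * pd i u ((t : ℂ) • ζ)‖ ≤ √n * ‖grad u ((t : ℂ) • ζ)‖ := by
      have := norm_sum_mul_le_norm_mul_norm ζ fun i => pd i u ((t : ℂ) • ζ)
      rwa [norm_toLp_unimodular hζ] at this
    have h2 : ‖grad u ((t : ℂ) • ζ)‖ ≤ (√n)⁻¹ * (t / (1 - t ^ 2)) * ‖u ((t : ℂ) • ζ)‖ := by
      have h3 := hY t ht'
      rw [norm_smul, norm_inv, inv_mul_le_iff₀ (norm_pos_iff.2 (hne t ht'))] at h3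
      linarith
    have h4 : ‖∑ i, ζ i * pd i u ((t : ℂ) • ζ)‖ * (1 - t ^ 2) ≤ t * ‖u ((t : ℂ) • ζ)‖ := by
      have h5 : √n * ((√n)⁻¹ * (t / (1 - t ^ 2)) * ‖u ((t : ℂ) • ζ)‖) * (1 - t ^ 2) =
          t * ‖u ((t : ℂ) • ζ)‖ := by field_simp
      rw [← h5]
      exact mul_le_mul_of_nonneg_right (h1.trans (mul_le_mul_of_nonneg_left h2 hs.le)) hl.le
    have h6 := neg_le_of_abs_le (abs_real_inner_le_norm (u ((t : ℂ) • ζ))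
      (∑ i, ζ i * pd i u ((t : ℂ) • ζ)))
    have h7 := mul_le_mul_of_nonneg_left h4 (norm_nonneg (u ((t : ℂ) • ζ)))
    have h8 := mul_le_mul_of_nonneg_right h6 hl.le
    nlinarith
  have := hmono (Set.left_mem_Icc.2 hR0) (Set.right_mem_Icc.2 hR0) hR0
  simp only [Complex.ofReal_zero, zero_smul, hu0, norm_one] at this
  rw [le_div_iff₀ (hlpos R (Set.right_mem_Icc.2 hR0))] at this
  linarith

/-- At a first zero $t_0$ the growth bound, valid on shorter segments, would pass to the limit and
give $1-t_0^2\le0$. -/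
theorem ne_zero_on_ray {u : (Fin n → ℂ) → ℂ} (hu : AnalyticOnNhd ℂ u (polydisk n)) (hu0 : u 0 ≠ 0)
    {ζ : Fin n → ℂ} (hζ : ∀ i, ‖ζ i‖ = 1)
    (hgrowth : ∀ R, 0 ≤ R → R < 1 → (∀ t ∈ Set.Icc (0 : ℝ) R, u ((t : ℂ) • ζ) ≠ 0) →
      1 - R ^ 2 ≤ ‖u ((R : ℂ) • ζ)‖ ^ 2) {R : ℝ} (hR : R < 1) :
    ∀ t ∈ Set.Icc (0 : ℝ) R, u ((t : ℂ) • ζ) ≠ 0 := by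
  by_contra! hcon
  have hcont : ContinuousOn (fun t : ℝ => u ((t : ℂ) • ζ)) (Set.Icc 0 R) := by
    refine hu.continuousOn.comp (by fun_prop) fun t ht i => ?_
    rw [Pi.smul_apply, norm_smul, hζ, Complex.norm_real, Real.norm_of_nonneg ht.1, mul_one]
    exact ht.2.trans_lt hR
  have hcomp : IsCompact (Set.Icc (0 : ℝ) R ∩ (fun t : ℝ => u ((t : ℂ) • ζ)) ⁻¹' {0}) :=
    isCompact_Icc.of_isClosed_subset
      (hcont.preimage_isClosed_of_isClosed isClosed_Icc isClosed_singleton) Set.inter_subset_left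
  obtain ⟨t₀, ⟨ht₀, hz₀⟩, hmin⟩ := hcomp.exists_isLeast hcon
  have ht₀pos : 0 < t₀ := by
    refine ht₀.1.lt_of_ne fun h => hu0 ?_
    have : u ((t₀ : ℂ) • ζ) = 0 := hz₀
    simpa [← h] using this
  have hlim : Filter.Tendsto (fun t : ℝ => ‖u ((t : ℂ) • ζ)‖ ^ 2) (nhdsWithin t₀ (Set.Ioo 0 t₀))
      (nhds (‖u ((t₀ : ℂ) • ζ)‖ ^ 2)) :=
    (((hcont t₀ ht₀).mono fun t ht => ⟨ht.1.le, ht.2.le.trans ht₀.2⟩).norm.pow 2)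
  have hlim' : Filter.Tendsto (fun t : ℝ => 1 - t ^ 2) (nhdsWithin t₀ (Set.Ioo 0 t₀))
      (nhds (1 - t₀ ^ 2)) :=
    (Continuous.tendsto (by fun_prop) t₀).mono_left nhdsWithin_le_nhds
  have hnebot : (nhdsWithin t₀ (Set.Ioo 0 t₀)).NeBot := right_nhdsWithin_Ioo_neBot ht₀pos
  have hle : 1 - t₀ ^ 2 ≤ ‖u ((t₀ : ℂ) • ζ)‖ ^ 2 := by
    refine le_of_tendsto_of_tendsto hlim' hlim ?_
    filter_upwards [self_mem_nhdsWithin] with t ht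
    refine hgrowth t ht.1.le (ht.2.trans_le (ht₀.2.trans hR.le)) fun s hs h0 => ?_
    exact (hmin ⟨⟨hs.1, hs.2.trans (ht.2.le.trans ht₀.2)⟩, h0⟩).not_gt (hs.2.trans_lt ht.2)
  have : u ((t₀ : ℂ) • ζ) = 0 := hz₀
  rw [this, norm_zero] at hle
  nlinarith [ht₀.2]

theorem differentiableAt_logGrad {u : (Fin n → ℂ) → ℂ} (hu : AnalyticOnNhd ℂ u (polydisk n))
    {z : Fin n → ℂ} (hz : z ∈ polydisk n) (h0 : u z ≠ 0) :
    DifferentiableAt ℂ (fun z => (u z)⁻¹ • grad u z) z := by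
  refine ((hu z hz).differentiableAt.fun_inv h0).fun_smul ?_
  rw [differentiableAt_euclidean]
  exact fun i => (analyticOnNhd_pd hu i z hz).differentiableAt

/-- If `|u|² ≥ 1 - r²` on the torus of radius `r` for every `r < 1`, then `u` has no zeros. -/
theorem ne_zero_of_torus {u : (Fin n → ℂ) → ℂ} (hu : AnalyticOnNhd ℂ u (polydisk n))
    (hu0 : u 0 ≠ 0)
    (htorus : ∀ r, 0 < r → r < 1 → ∀ z : Fin n → ℂ, (∀ i, ‖z i‖ = r) → 1 - r ^ 2 ≤ ‖u z‖ ^ 2) :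
    ∀ z ∈ polydisk n, u z ≠ 0 := by
  intro z₁ hz₁ hzero
  rw [polydisk_eq_ball, mem_ball_zero_iff] at hz₁
  have hsub : ∀ R < 1, Metric.closedBall (0 : Fin n → ℂ) R ⊆ polydisk n := by
    intro R hR
    rw [polydisk_eq_ball]
    exact Metric.closedBall_subset_ball hR
  have hcont : ContinuousOn u (Metric.closedBall 0 ‖z₁‖) := hu.continuousOn.mono (hsub _ hz₁)
  have hcomp : IsCompact (Metric.closedBall (0 : Fin n → ℂ) ‖z₁‖ ∩ u ⁻¹' {0}) :=
    (isCompact_closedBall _ _).of_isClosed_subset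
      (hcont.preimage_isClosed_of_isClosed Metric.isClosed_closedBall isClosed_singleton)
      Set.inter_subset_left
  -- At a zero of least norm, $1/u$ is still holomorphic on every smaller closed polydisk, so the
  -- torus bound controls it there; letting the radius grow contradicts $u(z_0)=0$.
  obtain ⟨z₀, ⟨hz₀, huz₀⟩, hmin⟩ := hcomp.exists_isMinOn ⟨z₁, by simp, hzero⟩
    continuous_norm.continuousOn
  have huz₀' : u z₀ = 0 := huz₀
  have hz₀1 : ‖z₀‖ < 1 := (mem_closedBall_zero_iff.1 hz₀).trans_lt hz₁
  have hz₀pos : 0 < ‖z₀‖ := by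
    refine norm_pos_iff.2 fun h => hu0 ?_
    rw [← h, huz₀']
  have hne : ∀ z, ‖z‖ < ‖z₀‖ → u z ≠ 0 := fun z hz h0 =>
    (hmin ⟨mem_closedBall_zero_iff.2 (hz.le.trans (mem_closedBall_zero_iff.1 hz₀)), h0⟩).not_gt hz
  have hsq : 0 < √(1 - ‖z₀‖ ^ 2) := Real.sqrt_pos.2 (by nlinarith)
  have hlow : ∀ z, 0 < ‖z‖ → ‖z‖ < ‖z₀‖ → √(1 - ‖z₀‖ ^ 2) ≤ ‖u z‖ := by
    intro z hzpos hz
    have hne' : ∀ x ∈ Metric.closedBall (0 : Fin n → ℂ) ‖z‖, u x ≠ 0 := fun x hx =>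
      hne x ((mem_closedBall_zero_iff.1 hx).trans_lt hz)
    have h := norm_le_of_forall_torus_norm_le (f := fun x => (u x)⁻¹) (C := (√(1 - ‖z₀‖ ^ 2))⁻¹)
      hzpos (fun x hx => ((hu x (hsub _ (hz.trans hz₀1) hx)).differentiableAt.fun_inv (hne' x hx)))
      (fun x hx => ?_) z (by simp)
    · rw [norm_inv] at h
      exact (inv_le_inv₀ (norm_pos_iff.2 (hne z hz)) hsq).1 h
    · rw [norm_inv]
      refine inv_anti₀ hsq (Real.sqrt_le_iff.2 ⟨norm_nonneg _, ?_⟩)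
      refine le_trans ?_ (htorus ‖z‖ hzpos (hz.trans hz₀1) x hx)
      nlinarith
  have hlim : Filter.Tendsto (fun t : ℝ => ‖u ((t : ℂ) • z₀)‖) (nhdsWithin 1 (Set.Ioo 0 1))
      (nhds ‖u z₀‖) := by
    have h1 : ContinuousAt u (((1 : ℝ) : ℂ) • z₀) := by
      rw [Complex.ofReal_one, one_smul]
      exact (hu z₀ (hsub _ hz₁ hz₀)).continuousAt
    have h2 : ContinuousAt (fun t : ℝ => (t : ℂ) • z₀) 1 := by fun_prop
    have h3 := (ContinuousAt.comp (g := u) (f := fun t : ℝ => (t : ℂ) • z₀) h1 h2).norm.tendsto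
    simp only [Function.comp_apply, Complex.ofReal_one, one_smul] at h3
    exact h3.mono_left nhdsWithin_le_nhds
  have hnebot : (nhdsWithin (1 : ℝ) (Set.Ioo 0 1)).NeBot := right_nhdsWithin_Ioo_neBot one_pos
  have hle : √(1 - ‖z₀‖ ^ 2) ≤ ‖u z₀‖ := by
    refine ge_of_tendsto hlim ?_
    filter_upwards [self_mem_nhdsWithin] with t ht
    have hn : ‖(t : ℂ) • z₀‖ = t * ‖z₀‖ := by
      rw [norm_smul, Complex.norm_real, Real.norm_of_nonneg ht.1.le]
    refine hlow _ ?_ ?_ <;> rw [hn]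
    · exact mul_pos ht.1 hz₀pos
    · exact mul_lt_of_lt_one_left hz₀pos ht.2
  rw [huz₀', norm_zero] at hle
  linarith

/-! ### Numerical condition -/

/-- The numerical condition that makes the comparison argument work. -/
theorem comparison_constant_lt_one (hn : 2 ≤ n) {α β K : ℝ} (hα0 : 0 ≤ α) (hβ : β = √2 * α)
    (hα : (n : ℝ) * √n * α ≤ 1 / 6.1) (hK : K ≤ β) (hK2 : n = 2 → K ≤ 13 / 15 * β) :
    β * √n + n * ((n * √n * β ^ 2 + 10 / 3 * K + 2 * (n - 1) * β) / (n - 1)) < 1 := by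
  have hβ0 : 0 ≤ β := by rw [hβ]; positivity
  rcases hn.eq_or_lt with h2 | h3
  · have hK' := hK2 h2.symm
    subst h2
    push_cast at hα ⊢
    have hs : √(2 : ℝ) ≤ 1.415 := Real.sqrt_le_iff.2 ⟨by norm_num, by norm_num⟩
    -- For $n=2$ the factor $\sqrt n$ cancels the $\sqrt2$ in $\beta$, giving $2\beta\le1/6.1$.
    have hβ1 : β ≤ 1 / 12.2 := by rw [hβ]; norm_num at hα ⊢; linarith
    have h1 : β * √2 ≤ 1 / 12.2 * 1.415 := mul_le_mul hβ1 hs (by positivity) (by norm_num)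
    have h4 : √2 * β ^ 2 ≤ 1.415 * (1 / 12.2) ^ 2 :=
      mul_le_mul hs (pow_le_pow_left₀ hβ0 hβ1 2) (by positivity) (by norm_num)
    norm_num at h1 h4 hβ1 ⊢
    linarith
  · have hn3 : (3 : ℝ) ≤ n := by exact_mod_cast h3
    set s := √(n : ℝ) with hs
    have hss : s * s = n := Real.mul_self_sqrt (Nat.cast_nonneg n)
    have hs1 : 1.7 ≤ s := Real.le_sqrt_of_sq_le (by norm_num; linarith)
    have hs2 : √(2 : ℝ) ≤ 1.415 := Real.sqrt_le_iff.2 ⟨by norm_num, by norm_num⟩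
    have hβs : β * s ^ 3 ≤ 0.24 := by
      have : β * s ^ 3 = √2 * (n * s * α) := by rw [hβ, ← hss]; ring
      rw [this]
      calc √2 * (n * s * α) ≤ 1.415 * (1 / 6.1) := mul_le_mul hs2 hα (by positivity) (by norm_num)
        _ ≤ 0.24 := by norm_num
    have hn1 : (0 : ℝ) < n - 1 := by linarith
    have hX0 : 0 ≤ n * s * β ^ 2 + 10 / 3 * β := by positivity
    -- For $n\ge3$ one has $n/(n-1)\le3/2$, and $K\le\beta$ suffices.
    have h1 : n * ((n * s * β ^ 2 + 10 / 3 * K + 2 * (n - 1) * β) / (n - 1)) ≤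
        3 / 2 * (n * s * β ^ 2 + 10 / 3 * β) + 2 * n * β := by
      rw [← mul_div_assoc, div_le_iff₀ hn1]
      nlinarith [mul_nonneg (sub_nonneg.2 hn3) hX0]
    have h4 : n * s * β ^ 2 ≤ 0.24 * β := by
      have : n * s * β ^ 2 = β * s ^ 3 * β := by rw [← hss]; ring
      rw [this]
      exact mul_le_mul_of_nonneg_right hβs hβ0
    -- The constant is $\tfrac32\cdot\tfrac{10}3+\tfrac32\cdot0.24=5.36$; the total is then at most
    -- $4\beta s^3\le0.96$.
    have h5 : β * (s + 5.36 + 2 * s ^ 2) ≤ β * (4 * s ^ 3) := by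
      refine mul_le_mul_of_nonneg_left ?_ hβ0
      nlinarith [mul_nonneg (sub_nonneg.2 hs1) (sub_nonneg.2 hs1), pow_pos (by linarith : 0 < s) 3,
        mul_nonneg (mul_nonneg (sub_nonneg.2 hs1) (sub_nonneg.2 hs1)) (by linarith : 0 ≤ s)]
    have h6 : (n : ℝ) * β = β * s ^ 2 := by rw [← hss]; ring
    nlinarith

end PolydiskSchwarzian

/-! ### Conclusion -/

theorem theorem3p8 (n : ℕ) (hn : 2 ≤ n)
    (P : Fin n → Fin n → Fin n → (Fin n → ℂ) → ℂ)
    (P₀ : Fin n → Fin n → (Fin n → ℂ) → ℂ)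
    (hP : PolydiskSchwarzian.HolomorphicCoeffs P P₀)
    (hint : PolydiskSchwarzian.CompletelyIntegrable P P₀)
    (hcan : PolydiskSchwarzian.CanonicalForm P)
    (α : ℝ≥0) (hnorm : PolydiskSchwarzian.schwarzianNorm P ≤ (α : ℝ≥0∞))
    (hα : (n : ℝ) * √(n : ℝ) * (α : ℝ) ≤ 1 / 6.1)
    (u : (Fin n → ℂ) → ℂ) (hu : PolydiskSchwarzian.IsSolution P P₀ u)
    (hu0 : u 0 = 1) (hgrad0 : PolydiskSchwarzian.grad u 0 = 0) :
    ∀ z ∈ PolydiskSchwarzian.polydisk n,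
      u z ≠ 0 ∧
        ‖(u z)⁻¹ • PolydiskSchwarzian.grad u z‖ ≤ ‖z‖ / (1 - ‖z‖ ^ 2) := by
  open PolydiskSchwarzian in
  set β : ℝ := √2 * α with hβdef
  have hβ : 0 ≤ β := by positivity
  have hn1 : 1 ≤ n := one_le_two.trans hn
  have hnR : (2 : ℝ) ≤ n := by exact_mod_cast hn
  have hu00 : u 0 ≠ 0 := by rw [hu0]; exact one_ne_zero
  have hS := fun z (hz : z ∈ polydisk n) => norm_weighted_schwarzianOp_le hnorm hz
  have hB : ∀ z ∈ polydisk n, ∀ v w,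
      ‖weighted z (bilinOp P z v w)‖ ≤ β * ‖weighted z v‖ * ‖weighted z w‖ := fun z hz =>
    norm_weighted_bilinOp_le hz (hint.coeff_symm hP hz) (hS z hz)
  have hcoeff := fun z (hz : z ∈ polydisk n) => norm_coeff_le hz (hB z hz)
  have hdiag : ∀ z ∈ polydisk n, ∀ i, ‖P i i i z‖ ≤ β / (1 - ‖z i‖ ^ 2) := by
    intro z hz i
    refine (hcoeff z hz i i i).trans_eq ?_
    have := (one_sub_sq_pos hz i).ne'
    field_simp
  obtain ⟨K, hK0, hKβ, hK2, hK⟩ : ∃ K, 0 ≤ K ∧ K ≤ β ∧ (n = 2 → K ≤ 13 / 15 * β) ∧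
      ∀ z ∈ polydisk n, ∀ i, ‖P i i i z‖ ≤ K / (1 - ‖z i‖ ^ 2) := by
    by_cases h2 : n = 2
    · subst h2
      exact ⟨13 / 15 * β, by positivity, by linarith, fun _ => le_rfl, fun z hz =>
        norm_coeff_diag_le_of_dim_two hβ hcan hz (hint.coeff_symm hP hz)
          (fun k i j => coeff_eq_zero hP hcoeff hz) (hS z hz)⟩
    · exact ⟨β, hβ, le_rfl, fun h => absurd h h2, hdiag⟩
  set D : ℝ := (n * √n * β ^ 2 + 10 / 3 * K + 2 * (n - 1) * β) / (n - 1) with hDdef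
  have hD : 0 ≤ D := by
    have : (0 : ℝ) ≤ n - 1 := by linarith
    positivity
  have hβD : β * √n + n * D < 1 := comparison_constant_lt_one hn α.2 hβdef hα hKβ hK2
  have hnormζ : ∀ ζ : Fin n → ℂ, (∀ i, ‖ζ i‖ = 1) → ∀ t : ℝ, 0 ≤ t → ∀ i,
      ‖((t : ℂ) • ζ) i‖ = t := by
    intro ζ hζ t ht i
    rw [Pi.smul_apply, norm_smul, hζ, Complex.norm_real, Real.norm_of_nonneg ht, mul_one]
  have hray : ∀ ζ : Fin n → ℂ, (∀ i, ‖ζ i‖ = 1) → ∀ R, 0 ≤ R → R < 1 →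
      (∀ t ∈ Set.Icc (0 : ℝ) R, u ((t : ℂ) • ζ) ≠ 0) →
      ∀ t ∈ Set.Icc (0 : ℝ) R, ‖(u ((t : ℂ) • ζ))⁻¹ • grad u ((t : ℂ) • ζ)‖ ≤
        (√n)⁻¹ * (t / (1 - t ^ 2)) := by
    intro ζ hζ R _ hR hne
    refine norm_logGrad_le_on_ray hu hgrad0 hn1 hβ hD hβD hζ hR
      (fun t ht0 ht1 => norm_bilinOp_le_of_torus ht1 ht0 (hnormζ ζ hζ t ht0)
        (hB _ fun i => (hnormζ ζ hζ t ht0 i).trans_lt ht1)) (fun t ht0 ht1 j => ?_) hne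
    have h := norm_coeff_zero_le_of_torus hP hint hcan hβ hB hK ht0 ht1 (hnormζ ζ hζ t ht0) hζ hn1 j
    have hpos : (0 : ℝ) < n - 1 := by linarith
    rw [← le_div_iff₀' hpos] at h
    refine h.trans_eq ?_
    rw [hDdef, div_right_comm]
  have hgrowth : ∀ ζ : Fin n → ℂ, (∀ i, ‖ζ i‖ = 1) → ∀ R, 0 ≤ R → R < 1 →
      (∀ t ∈ Set.Icc (0 : ℝ) R, u ((t : ℂ) • ζ) ≠ 0) → 1 - R ^ 2 ≤ ‖u ((R : ℂ) • ζ)‖ ^ 2 :=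
    fun ζ hζ R hR0 hR hne =>
      one_sub_sq_le_norm_sq_on_ray hu.1 hu0 hn1 hζ hR0 hR hne (hray ζ hζ R hR0 hR hne)
  have hneray : ∀ ζ : Fin n → ℂ, (∀ i, ‖ζ i‖ = 1) → ∀ R < 1,
      ∀ t ∈ Set.Icc (0 : ℝ) R, u ((t : ℂ) • ζ) ≠ 0 :=
    fun ζ hζ R hR => ne_zero_on_ray hu.1 hu00 hζ (hgrowth ζ hζ) hR
  have hdirection : ∀ r, 0 < r → ∀ z : Fin n → ℂ, (∀ i, ‖z i‖ = r) →
      ∃ ζ : Fin n → ℂ, (∀ i, ‖ζ i‖ = 1) ∧ (r : ℂ) • ζ = z := by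
    intro r hr z hz
    refine ⟨(r : ℂ)⁻¹ • z, fun i => ?_, smul_inv_smul₀ (Complex.ofReal_ne_zero.2 hr.ne') z⟩
    rw [Pi.smul_apply, norm_smul, norm_inv, Complex.norm_real, Real.norm_of_nonneg hr.le, hz,
      inv_mul_cancel₀ hr.ne']
  have hne : ∀ z ∈ polydisk n, u z ≠ 0 := by
    refine ne_zero_of_torus hu.1 hu00 fun r hr hr1 z hz => ?_
    obtain ⟨ζ, hζ, rfl⟩ := hdirection r hr z hz
    exact hgrowth ζ hζ r hr.le hr1 (hneray ζ hζ r hr1)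
  intro z hz
  refine ⟨hne z hz, ?_⟩
  rcases eq_or_ne z 0 with rfl | hz0
  · simp [hgrad0]
  have hr : 0 < ‖z‖ := norm_pos_iff.2 hz0
  have hr1 : ‖z‖ < 1 := by rwa [polydisk_eq_ball, mem_ball_zero_iff] at hz
  have hsub : Metric.closedBall (0 : Fin n → ℂ) ‖z‖ ⊆ polydisk n := by
    rw [polydisk_eq_ball]; exact Metric.closedBall_subset_ball hr1
  -- The vector-valued holomorphic map $\nabla u/u$ attains its bound on the torus of radius
  -- $|z|_\infty$, where the ray estimate applies; its factor $n^{-1/2}\le1$ is discarded.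
  refine norm_le_of_forall_torus_norm_le (f := fun z => (u z)⁻¹ • grad u z) hr
    (fun x hx => differentiableAt_logGrad hu.1 (hsub hx) (hne x (hsub hx))) (fun x hx => ?_) z
    (by simp)
  obtain ⟨ζ, hζ, rfl⟩ := hdirection ‖z‖ hr x hx
  refine (hray ζ hζ ‖z‖ hr.le hr1 (hneray ζ hζ _ hr1) ‖z‖ ⟨hr.le, le_rfl⟩).trans ?_
  have hl : 0 < 1 - ‖z‖ ^ 2 := by nlinarith
  refine mul_le_of_le_one_left (by positivity) (inv_le_one_of_one_le₀ ?_)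
  exact Real.one_le_sqrt.2 (by linarith)
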